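/- Let $\mathcal C=(C,P,\partial)$ be a crossed module and let $K$ be an (abstract) simplicial complex. **Formal maps.** A *vertex order* on $K$ is a partial order on the vertices that is total on each simplex. A *formal $\mathcal C$-map* on $K$ consists of a vertex order, elements $p_e\in P$ for the edges $e$ and $c_t\in C$ for the triangles $t$ of $K$, such that for each triangle $v_0<v_1<v_2$ one has the boundary condition $\partial c_t=p_{02}\,p_{12}^{-1}\,p_{01}^{-1}$, and for each tetrahedron $v_0<v_1<v_2<v_3$ one has the cocycle condition $c_{013}\cdot{}^{p_{01}}c_{123}=c_{023}\cdot c_{012}$. **Start vertices.** More generally, a *formal $\mathcal C$-map with start vertices* has, besides the vertex order (which orients the triangles), a chosen start vertex in each simplex: $p_e$ refers to the direction of $e$ away from its start vertex, so that each directed edge has a label $p(u,v)=p(v,u)^{-1}$, with $p(u,u)=1$; the boundary condition of a triangle is read off from its start vertex, that is, $\partial c_t=p(a,d)\,p(d,b)\,p(b,a)$ where $a$ is the start vertex of $t$ and $(a,b,d)$ is the cyclic rotation of the increasing enumeration of $t$ that begins with $a$; and the cocycle condition is the one above, with each $c_t$ transported by the action of $P$ to the first vertex of $t$ in the order, both sides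 being read at the start vertex of the tetrahedron. The formal $\mathcal C$-maps of the previous paragraph are those for which the start vertex of each simplex is its first vertex. **Equivalence.** Let $K_0,K_1$ be triangulations of a space $X$ by specified homeomorphisms $|K_i|\cong X$ (with the weak topology on $|K_i|$), and let $\mathbf m\subseteq X$ be a set of base points that are vertices of both. Formal maps $\lambda_0$ on $K_0$ and $\lambda_1$ on $K_1$ are *equivalent* (relative to $\mathbf m$) if there are a triangulation $T$ of $X\times I$ extending $K_0$ on $X\times\{0\}$ and $K_1$ on $X\times\{1\}$, and a formal $\mathcal C$-map $\Lambda$ on $T$ that restricts to $\lambda_0$ and $\lambda_1$ (orders and labels) on the two ends, such that for each $x\in\mathbf m$ the segment $\{x\}\times I$ is subdivided by $T$ and $\Lambda$ assigns $1_P$ to each edge of $T$ contained in $\{x\}\times I$. Equivalence of formal maps with start vertices is defined in the same way, $\Lambda$ then having start vertices that restrict to the given ones. **Relabelling.** Let $\lambda$ be a formal $\mathcal C$-map on $K$, with start vertices, and let a new vertex order and new start vertices be given. The *relabelling* of $\lambda$ has the same labels $p(u,v)$ of directed edges as $\lambda$ (so $p_e$ is inverted exactly when the start vertex of $e$ changes),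 and assigns to a triangle $t$ with old start vertex $a$ and new start vertex $a'$ the element ${}^{p(a',a)}c_t$ if the two orders induce the same orientation of $t$, and $\bigl({}^{p(a',a)}c_t\bigr)^{-1}$ otherwise. **Proposition.** Let $X$ be a space triangulated by $K$, with any set $\mathbf m$ of vertices as base points. 1. (Change of order.) Let $\lambda$ be a formal $\mathcal C$-map on $K$ and let $\le'$ be any vertex order on $K$. Then the relabelling $\lambda'$ of $\lambda$ with respect to $\le'$ (each start vertex being the first vertex of its simplex) is a formal $\mathcal C$-map on $K$ with order $\le'$, and $\lambda'$ is equivalent to $\lambda$. 2. (Change of start vertices.) Let $\lambda$ be a formal $\mathcal C$-map with start vertices on $K$, and let any vertex order $\le'$ and any choice $s'$ of start vertices be given ($\le'$ may be the order of $\lambda$). Then the relabelling $\lambda'$ of $\lambda$ is a formal $\mathcal C$-map with order $\le'$ and start vertices $s'$, and $\lambda'$ is equivalent to $\lambda$. -/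

import Mathlib

universe u

/-- A crossed module `(C, P, ∂)`: the left action of `P` on `C` by group automorphisms is
the `MulDistribMulAction` instance. -/
structure CrossedModule (C P : Type*) [Group C] [Group P] [MulDistribMulAction P C] where
  bd : C →* P
  bd_smul : ∀ (p : P) (c : C), bd (p • c) = p * bd c * p⁻¹
  peiffer : ∀ c c' : C, bd c • c' = c * c' * c⁻¹

namespace AbstractSimplicialComplex

/-- The set `K_n` of `n`-simplices of `K`. -/
abbrev Simplices {V : Type*} (K : AbstractSimplicialComplex V) (n : ℕ) : Type _ :=
  {σ : Finset V // σ ∈ K.faces ∧ σ.card = n + 1}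

/-- An `n`-simplex, regarded as a face. -/
def Simplices.toFace {V : Type*} {K : AbstractSimplicialComplex V} {n : ℕ} (σ : K.Simplices n) :
    K.faces :=
  ⟨σ.1, σ.2.1⟩

/-- A partial order on the vertices of `K` whose restriction to each simplex is total. -/
structure VertexOrder {V : Type*} (K : AbstractSimplicialComplex V) where
  toPartialOrder : PartialOrder V
  total : ∀ σ ∈ K.faces, ∀ u ∈ σ, ∀ v ∈ σ, toPartialOrder.le u v ∨ toPartialOrder.le v u

/-- A choice of a start vertex in every simplex of `K`. -/
structure StartVertices {V : Type*} (K : AbstractSimplicialComplex V) where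
  start : K.faces → V
  start_mem : ∀ σ : K.faces, start σ ∈ σ.1

namespace VertexOrder

variable {V : Type*} {K : AbstractSimplicialComplex V}

def Le (o : VertexOrder K) (u v : V) : Prop := o.toPartialOrder.le u v

def Lt (o : VertexOrder K) (u v : V) : Prop := o.toPartialOrder.lt u v

/-- `(a, b, d)` is an even permutation of the increasing enumeration of `{a, b, d}`. -/
def Cyclic (o : VertexOrder K) (a b d : V) : Prop :=
  (o.Lt a b ∧ o.Lt b d) ∨ (o.Lt b d ∧ o.Lt d a) ∨ (o.Lt d a ∧ o.Lt a b)

theorem lt_trans (o : VertexOrder K) {a b d : V} (h : o.Lt a b) (h' : o.Lt b d) : o.Lt a d :=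
  letI := o.toPartialOrder
  _root_.lt_trans (α := V) h h'

theorem not_le_of_lt (o : VertexOrder K) {a b : V} (h : o.Lt a b) : ¬ o.Le b a :=
  letI := o.toPartialOrder
  _root_.not_le_of_gt (α := V) h

theorem le_of_lt (o : VertexOrder K) {a b : V} (h : o.Lt a b) : o.Le a b :=
  letI := o.toPartialOrder
  _root_.le_of_lt (α := V) h

theorem ne_of_lt (o : VertexOrder K) {a b : V} (h : o.Lt a b) : a ≠ b :=
  letI := o.toPartialOrder
  _root_.ne_of_lt (α := V) h

theorem le_refl (o : VertexOrder K) (a : V) : o.Le a a :=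
  o.toPartialOrder.le_refl a

theorem exists_first (o : VertexOrder K) (σ : K.faces) : ∃ v ∈ σ.1, ∀ w ∈ σ.1, o.Le v w := by
  let _ := o.toPartialOrder
  obtain ⟨m, hm, hmin⟩ := Finset.exists_minimal (s := σ.1) (K.isRelLowerSet_faces σ.2).1
  refine ⟨m, hm, fun w hw => ?_⟩
  rcases o.total σ.1 σ.2 m hm w hw with h | h
  · exact h
  · exact hmin hw h

theorem exists_edge (o : VertexOrder K) {u v : V} (h : o.Lt u v) (σ : K.faces) (hu : u ∈ σ.1)
    (hv : v ∈ σ.1) : ∃ e : K.Simplices 1, (e.1 : Set V) = {u, v} := by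
  classical
  refine ⟨⟨{u, v}, (K.isRelLowerSet_faces σ.2).2 ?_ ⟨u, by simp⟩,
    Finset.card_pair (o.ne_of_lt h)⟩, by simp⟩
  intro w hw
  rcases Finset.mem_insert.1 hw with rfl | hw
  · exact hu
  · rw [Finset.mem_singleton.1 hw]
    exact hv

/-- The start vertices given by the order: the first vertex of each simplex. -/
noncomputable def firstVertices (o : VertexOrder K) : StartVertices K where
  start σ := (o.exists_first σ).choose
  start_mem σ := (o.exists_first σ).choose_spec.1

theorem firstVertices_eq (o : VertexOrder K) (σ : K.faces) {v : V} (hv : v ∈ σ.1)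
    (h : ∀ w ∈ σ.1, o.Le v w) : o.firstVertices.start σ = v :=
  letI := o.toPartialOrder
  _root_.le_antisymm (α := V) ((o.exists_first σ).choose_spec.2 v hv)
    (h _ (o.exists_first σ).choose_spec.1)

end VertexOrder

end AbstractSimplicialComplex

/-! ### Formal maps -/

section FormalMaps

open AbstractSimplicialComplex

variable {C P : Type*} [Group C] [Group P] [MulDistribMulAction P C]

/-- A formal `𝒞`-map on `K`: a vertex order, labels `p` of the edges and `c` of the triangles,
subject to the boundary condition and the cocycle condition. Here `ei` and `ti` denote the edge
and the triangle opposite to the vertex `vi`. -/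
structure FormalMap (𝒞 : CrossedModule C P) {V : Type*} (K : AbstractSimplicialComplex V) where
  order : VertexOrder K
  p : K.Simplices 1 → P
  c : K.Simplices 2 → C
  boundary : ∀ (v0 v1 v2 : V), order.Lt v0 v1 → order.Lt v1 v2 →
    ∀ (t : K.Simplices 2) (e0 e1 e2 : K.Simplices 1), (t.1 : Set V) = {v0, v1, v2} →
    (e0.1 : Set V) = {v1, v2} → (e1.1 : Set V) = {v0, v2} → (e2.1 : Set V) = {v0, v1} →
    𝒞.bd (c t) = p e1 * (p e0)⁻¹ * (p e2)⁻¹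
  cocycle : ∀ (v0 v1 v2 v3 : V), order.Lt v0 v1 → order.Lt v1 v2 → order.Lt v2 v3 →
    ∀ (s : K.Simplices 3) (t0 t1 t2 t3 : K.Simplices 2) (e01 : K.Simplices 1),
    (s.1 : Set V) = {v0, v1, v2, v3} →
    (t0.1 : Set V) = {v1, v2, v3} → (t1.1 : Set V) = {v0, v2, v3} →
    (t2.1 : Set V) = {v0, v1, v3} → (t3.1 : Set V) = {v0, v1, v2} →
    (e01.1 : Set V) = {v0, v1} →
    c t2 * p e01 • c t0 = c t1 * c t3

open Classical in
/-- The label of the edge path from `u` to `v`, for edge labels `p` which refer to the direction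
away from the start vertex of each edge. (It is `1` if `{u, v}` is not an edge; it is only used
for `u = v` and for edges.) -/
noncomputable def edgeLabel {V : Type*} {K : AbstractSimplicialComplex V} (s : StartVertices K)
    (p : K.Simplices 1 → P) (u v : V) : P :=
  if h : ({u, v} : Finset V) ∈ K.faces ∧ ({u, v} : Finset V).card = 1 + 1 then
    if s.start ⟨{u, v}, h.1⟩ = u then p ⟨{u, v}, h⟩ else (p ⟨{u, v}, h⟩)⁻¹
  else 1

/-- The label of the triangle `t`, transported from its start vertex to its vertex `v`. -/
noncomputable def faceLabel {V : Type*} {K : AbstractSimplicialComplex V} (s : StartVertices K)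
    (p : K.Simplices 1 → P) (c : K.Simplices 2 → C) (v : V) (t : K.Simplices 2) : C :=
  edgeLabel s p v (s.start t.toFace) • c t

/-- A formal `𝒞`-map on `K` with arbitrary start vertices. The vertex order orients the triangles,
an edge is labelled in the direction away from its start vertex, the boundary of a triangle is read
off from its start vertex, and the cocycle condition of a tetrahedron is read off at its start
vertex. -/
structure MarkedFormalMap (𝒞 : CrossedModule C P) {V : Type*}
    (K : AbstractSimplicialComplex V) where
  order : VertexOrder K
  starts : StartVertices K
  p : K.Simplices 1 → P
  c : K.Simplices 2 → C
  boundary : ∀ (t : K.Simplices 2) (a b d : V), (t.1 : Set V) = {a, b, d} → order.Cyclic a b d →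
    starts.start t.toFace = a →
    𝒞.bd (c t) = edgeLabel starts p a d * edgeLabel starts p d b * edgeLabel starts p b a
  cocycle : ∀ (v0 v1 v2 v3 : V), order.Lt v0 v1 → order.Lt v1 v2 → order.Lt v2 v3 →
    ∀ (s : K.Simplices 3) (t0 t1 t2 t3 : K.Simplices 2),
    (s.1 : Set V) = {v0, v1, v2, v3} →
    (t0.1 : Set V) = {v1, v2, v3} → (t1.1 : Set V) = {v0, v2, v3} →
    (t2.1 : Set V) = {v0, v1, v3} → (t3.1 : Set V) = {v0, v1, v2} →
    edgeLabel starts p (starts.start s.toFace) v0 •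
        (faceLabel starts p c v0 t2 * edgeLabel starts p v0 v1 • faceLabel starts p c v1 t0) =
      edgeLabel starts p (starts.start s.toFace) v0 •
        (faceLabel starts p c v0 t1 * faceLabel starts p c v0 t3)

variable {𝒞 : CrossedModule C P} {V : Type*} {K : AbstractSimplicialComplex V}

theorem edgeLabel_self (s : StartVertices K) (p : K.Simplices 1 → P) (u : V) :
    edgeLabel s p u u = 1 := by
  simp [edgeLabel]

theorem edgeLabel_of_lt (o : VertexOrder K) (p : K.Simplices 1 → P) {u v : V} (h : o.Lt u v)
    (e : K.Simplices 1) (he : (e.1 : Set V) = {u, v}) :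
    edgeLabel o.firstVertices p u v = p e ∧ edgeLabel o.firstVertices p v u = (p e)⁻¹ := by
  classical
  have he' : e.1 = {u, v} := by
    apply Finset.coe_injective
    rw [he]
    simp
  obtain ⟨e, hK, hc⟩ := e
  dsimp only at he'
  have hcomm : ({v, u} : Finset V) = e := (Finset.pair_comm v u).trans he'.symm
  have h1 : o.firstVertices.start ⟨e, hK⟩ = u := by
    refine o.firstVertices_eq _ (by simp [he']) ?_
    intro w hw
    have hw' : w ∈ ({u, v} : Finset V) := he' ▸ (show w ∈ e from hw)
    rcases Finset.mem_insert.1 hw' with rfl | hw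
    · exact o.le_refl _
    · rw [Finset.mem_singleton.1 hw]
      exact o.le_of_lt h
  have key : ∀ (a b : V), ({a, b} : Finset V) = e → edgeLabel o.firstVertices p a b =
      if o.firstVertices.start ⟨e, hK⟩ = a then p ⟨e, hK, hc⟩ else (p ⟨e, hK, hc⟩)⁻¹ := by
    rintro a b rfl
    unfold edgeLabel
    convert dif_pos (⟨hK, hc⟩ : _ ∧ _) using 1
  constructor
  · rw [key u v he'.symm, if_pos h1]
  · rw [key v u hcomm, h1, if_neg (o.ne_of_lt h)]

/-- A formal map is a marked formal map whose start vertices are the first vertices. -/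
noncomputable def FormalMap.toMarked (lam : FormalMap 𝒞 K) : MarkedFormalMap 𝒞 K where
  order := lam.order
  starts := lam.order.firstVertices
  p := lam.p
  c := lam.c
  boundary := by
    intro t a b d ht hcyc ha
    have hmem : ∀ w : V, w ∈ t.1 ↔ w = a ∨ w = b ∨ w = d := fun w => by
      rw [← Finset.mem_coe, ht]
      simp
    have hmin : ∀ w ∈ t.1, lam.order.Le a w := by
      obtain ⟨v, hv, hvle⟩ := lam.order.exists_first t.toFace
      rwa [← lam.order.firstVertices_eq t.toFace hv hvle, ha] at hvle
    have hab : lam.order.Lt a b ∧ lam.order.Lt b d := by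
      rcases hcyc with h | ⟨-, h⟩ | ⟨h, -⟩
      · exact h
      · exact absurd (hmin d ((hmem d).2 (by simp))) (lam.order.not_le_of_lt h)
      · exact absurd (hmin d ((hmem d).2 (by simp))) (lam.order.not_le_of_lt h)
    have had := lam.order.lt_trans hab.1 hab.2
    obtain ⟨e0, he0⟩ := lam.order.exists_edge hab.2 t.toFace ((hmem b).2 (by simp))
      ((hmem d).2 (by simp))
    obtain ⟨e1, he1⟩ := lam.order.exists_edge had t.toFace ((hmem a).2 (by simp))
      ((hmem d).2 (by simp))
    obtain ⟨e2, he2⟩ := lam.order.exists_edge hab.1 t.toFace ((hmem a).2 (by simp))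
      ((hmem b).2 (by simp))
    rw [(edgeLabel_of_lt lam.order lam.p had e1 he1).1,
      (edgeLabel_of_lt lam.order lam.p hab.2 e0 he0).2,
      (edgeLabel_of_lt lam.order lam.p hab.1 e2 he2).2]
    exact lam.boundary a b d hab.1 hab.2 t e0 e1 e2 ht he0 he1 he2
  cocycle := by
    intro v0 v1 v2 v3 h01 h12 h23 s t0 t1 t2 t3 hs ht0 ht1 ht2 ht3
    have hmem : ∀ w : V, w ∈ s.1 ↔ w = v0 ∨ w = v1 ∨ w = v2 ∨ w = v3 := fun w => by
      rw [← Finset.mem_coe, hs]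
      simp
    obtain ⟨e01, he01⟩ := lam.order.exists_edge h01 s.toFace ((hmem v0).2 (by simp))
      ((hmem v1).2 (by simp))
    have hface : ∀ (t : K.Simplices 2) (a b d : V), lam.order.Lt a b → lam.order.Lt b d →
        (t.1 : Set V) = {a, b, d} →
        faceLabel lam.order.firstVertices lam.p lam.c a t = lam.c t := by
      intro t a b d hab hbd ht
      have hm : ∀ w : V, w ∈ t.1 ↔ w = a ∨ w = b ∨ w = d := fun w => by
        rw [← Finset.mem_coe, ht]
        simp
      have hfirst : lam.order.firstVertices.start t.toFace = a := by
        refine lam.order.firstVertices_eq _ ((hm a).2 (by simp)) ?_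
        intro w hw
        rcases (hm w).1 hw with rfl | rfl | rfl
        · exact lam.order.le_refl _
        · exact lam.order.le_of_lt hab
        · exact lam.order.le_of_lt (lam.order.lt_trans hab hbd)
      rw [faceLabel, hfirst, edgeLabel_self, one_smul]
    have h02 := lam.order.lt_trans h01 h12
    have h13 := lam.order.lt_trans h12 h23
    rw [hface t2 v0 v1 v3 h01 h13 ht2, hface t0 v1 v2 v3 h12 h23 ht0,
      hface t1 v0 v2 v3 h02 h23 ht1, hface t3 v0 v1 v2 h01 h12 ht3,
      (edgeLabel_of_lt lam.order lam.p h01 e01 he01).1,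
      lam.cocycle v0 v1 v2 v3 h01 h12 h23 s t0 t1 t2 t3 e01 hs ht0 ht1 ht2 ht3 he01]

/-- `mu` consists of the labels of `lam`, read off with respect to the vertex order and the start
vertices of `mu`: the labels of directed edges agree; the label of a triangle is transported to the
new start vertex by the action of `P`, and inverted if its orientation has changed. -/
structure MarkedFormalMap.IsRelabelling (lam mu : MarkedFormalMap 𝒞 K) : Prop where
  edge : ∀ u v : V, edgeLabel mu.starts mu.p u v = edgeLabel lam.starts lam.p u v
  face_same : ∀ (t : K.Simplices 2) (a b d : V), (t.1 : Set V) = {a, b, d} →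
    lam.order.Cyclic a b d → mu.order.Cyclic a b d →
    mu.c t = faceLabel lam.starts lam.p lam.c (mu.starts.start t.toFace) t
  face_opposite : ∀ (t : K.Simplices 2) (a b d : V), (t.1 : Set V) = {a, b, d} →
    lam.order.Cyclic a b d → mu.order.Cyclic a d b →
    mu.c t = (faceLabel lam.starts lam.p lam.c (mu.starts.start t.toFace) t)⁻¹

end FormalMaps

/-! ### Geometric realisations and triangulations -/

namespace AbstractSimplicialComplex

variable {V W : Type*}

/-- The geometric realisation of `K`, in barycentric coordinates. -/
def Realization (K : AbstractSimplicialComplex V) : Type _ :=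
  {x : V →₀ ℝ // (∀ v, 0 ≤ x v) ∧ x.support ∈ K.faces ∧ (x.sum fun _ r => r) = 1}

/-- The closed simplex of the realisation spanned by `σ`. -/
def closedSimplex (K : AbstractSimplicialComplex V) (σ : Finset V) : Set K.Realization :=
  {x | x.1.support ⊆ σ}

/-- The weak topology: each closed simplex carries its Euclidean topology, and a set is open if and
only if its intersection with every closed simplex is open in that simplex. -/
instance (K : AbstractSimplicialComplex V) : TopologicalSpace K.Realization :=
  ⨆ σ : K.faces, TopologicalSpace.coinduced
    (Subtype.val : K.closedSimplex σ.1 → K.Realization)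
    (TopologicalSpace.induced (fun (x : K.closedSimplex σ.1) (v : V) => x.1.1 v) inferInstance)

/-- The point of the realisation given by a vertex. -/
noncomputable def vertexPoint (K : AbstractSimplicialComplex V) (v : V) : K.Realization :=
  ⟨Finsupp.single v 1, by
    classical
    refine ⟨fun w => ?_, ?_, ?_⟩
    · rw [Finsupp.single_apply]
      split_ifs <;> norm_num
    · have hs : (Finsupp.single v (1 : ℝ)).support = {v} := by
        ext w
        simp [eq_comm]
      rw [hs]
      exact K.singleton_mem v
    · simp⟩

/-- An injective simplicial map, i.e. an isomorphism onto a subcomplex. -/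
structure Embedding (K : AbstractSimplicialComplex V) (L : AbstractSimplicialComplex W) where
  toEmbedding : V ↪ W
  map_mem : ∀ σ ∈ K.faces, σ.map toEmbedding ∈ L.faces

namespace Embedding

variable {K : AbstractSimplicialComplex V} {L : AbstractSimplicialComplex W}

def mapFace (i : Embedding K L) (σ : K.faces) : L.faces :=
  ⟨σ.1.map i.toEmbedding, i.map_mem σ.1 σ.2⟩

def mapSimplex (i : Embedding K L) {n : ℕ} (σ : K.Simplices n) : L.Simplices n :=
  ⟨σ.1.map i.toEmbedding, i.map_mem σ.1 σ.2.1, by rw [Finset.card_map]; exact σ.2.2⟩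

/-- The affine extension of an injective simplicial map to the realisations. -/
noncomputable def realize (i : Embedding K L) (x : K.Realization) : L.Realization :=
  ⟨x.1.embDomain i.toEmbedding, by
    refine ⟨fun w => ?_, ?_, ?_⟩
    · by_cases hw : w ∈ Set.range i.toEmbedding
      · obtain ⟨v, rfl⟩ := hw
        rw [Finsupp.embDomain_apply_self]
        exact x.2.1 v
      · rw [Finsupp.embDomain_of_notMem_range _ _ _ hw]
    · rw [Finsupp.support_embDomain]
      exact i.map_mem _ x.2.2.1
    · rw [Finsupp.sum_embDomain]
      exact x.2.2.2⟩

end Embedding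

/-- A triangulation `T` of `X × I` extending the triangulations `K₀` and `K₁` of `X` (given by the
homeomorphisms `h₀` and `h₁`) on `X × {0}` and `X × {1}`. -/
structure CylinderTriangulation {X : Type*} [TopologicalSpace X] {V₀ V₁ : Type u}
    {K₀ : AbstractSimplicialComplex V₀} {K₁ : AbstractSimplicialComplex V₁}
    (h₀ : K₀.Realization ≃ₜ X) (h₁ : K₁.Realization ≃ₜ X) where
  Vert : Type u
  T : AbstractSimplicialComplex Vert
  homeo : T.Realization ≃ₜ X × unitInterval
  i₀ : Embedding K₀ T
  i₁ : Embedding K₁ T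
  homeo_i₀ : ∀ x : K₀.Realization, homeo (i₀.realize x) = (h₀ x, 0)
  homeo_i₁ : ∀ x : K₁.Realization, homeo (i₁.realize x) = (h₁ x, 1)

namespace CylinderTriangulation

variable {X : Type*} [TopologicalSpace X] {V₀ V₁ : Type u}
  {K₀ : AbstractSimplicialComplex V₀} {K₁ : AbstractSimplicialComplex V₁}
  {h₀ : K₀.Realization ≃ₜ X} {h₁ : K₁.Realization ≃ₜ X}

/-- The closed simplex spanned by `σ` lies in `{x} × I`. -/
def OnLine (Z : CylinderTriangulation h₀ h₁) (x : X) (σ : Finset Z.Vert) : Prop :=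
  ∀ y ∈ Z.T.closedSimplex σ, (Z.homeo y).1 = x

/-- The triangulation contains a subdivided `{x} × I`, for every base point `x`. -/
def ContainsLines (Z : CylinderTriangulation h₀ h₁) (m : Set X) : Prop :=
  ∀ x ∈ m, ∀ r : unitInterval, ∃ σ ∈ Z.T.faces,
    Z.OnLine x σ ∧ Z.homeo.symm (x, r) ∈ Z.T.closedSimplex σ

end CylinderTriangulation

end AbstractSimplicialComplex

/-! ### Equivalence of formal maps -/

section Equivalence

open AbstractSimplicialComplex

variable {C P : Type*} [Group C] [Group P] [MulDistribMulAction P C] {𝒞 : CrossedModule C P}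

/-- `Lam` restricts to `lam` along the embedding `i`. -/
structure FormalMap.Extends {V W : Type*} {K : AbstractSimplicialComplex V}
    {L : AbstractSimplicialComplex W} (Lam : FormalMap 𝒞 L) (i : Embedding K L)
    (lam : FormalMap 𝒞 K) : Prop where
  order : ∀ u v : V, Lam.order.Le (i.toEmbedding u) (i.toEmbedding v) ↔ lam.order.Le u v
  p : ∀ e : K.Simplices 1, Lam.p (i.mapSimplex e) = lam.p e
  c : ∀ t : K.Simplices 2, Lam.c (i.mapSimplex t) = lam.c t

/-- `Lam`, with its order and its start vertices, restricts to `lam` along the embedding `i`. -/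
structure MarkedFormalMap.Extends {V W : Type*} {K : AbstractSimplicialComplex V}
    {L : AbstractSimplicialComplex W} (Lam : MarkedFormalMap 𝒞 L) (i : Embedding K L)
    (lam : MarkedFormalMap 𝒞 K) : Prop where
  order : ∀ u v : V, Lam.order.Le (i.toEmbedding u) (i.toEmbedding v) ↔ lam.order.Le u v
  starts : ∀ σ : K.faces, Lam.starts.start (i.mapFace σ) = i.toEmbedding (lam.starts.start σ)
  p : ∀ e : K.Simplices 1, Lam.p (i.mapSimplex e) = lam.p e
  c : ∀ t : K.Simplices 2, Lam.c (i.mapSimplex t) = lam.c t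

variable {X : Type*} [TopologicalSpace X] {V₀ V₁ : Type u}
  {K₀ : AbstractSimplicialComplex V₀} {K₁ : AbstractSimplicialComplex V₁}

/-- Equivalence of formal maps on two triangulations of `X`, relative to the set `m` of base
points. -/
def FormalMap.Equivalent (m : Set X) (h₀ : K₀.Realization ≃ₜ X) (h₁ : K₁.Realization ≃ₜ X)
    (lam₀ : FormalMap 𝒞 K₀) (lam₁ : FormalMap 𝒞 K₁) : Prop :=
  ∃ (Z : CylinderTriangulation h₀ h₁) (Lam : FormalMap 𝒞 Z.T),
    Lam.Extends Z.i₀ lam₀ ∧ Lam.Extends Z.i₁ lam₁ ∧ Z.ContainsLines m ∧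
    ∀ x ∈ m, ∀ e : Z.T.Simplices 1, Z.OnLine x e.1 → Lam.p e = 1

/-- Equivalence of marked formal maps on two triangulations of `X`, relative to the set `m` of base
points. -/
def MarkedFormalMap.Equivalent (m : Set X) (h₀ : K₀.Realization ≃ₜ X) (h₁ : K₁.Realization ≃ₜ X)
    (lam₀ : MarkedFormalMap 𝒞 K₀) (lam₁ : MarkedFormalMap 𝒞 K₁) : Prop :=
  ∃ (Z : CylinderTriangulation h₀ h₁) (Lam : MarkedFormalMap 𝒞 Z.T),
    Lam.Extends Z.i₀ lam₀ ∧ Lam.Extends Z.i₁ lam₁ ∧ Z.ContainsLines m ∧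
    ∀ x ∈ m, ∀ e : Z.T.Simplices 1, Z.OnLine x e.1 → Lam.p e = 1

end Equivalence

/-!
The labels of a formal map can be read off without reference to the vertex order and the start
vertices. A marked formal map determines labels `p u v` of directed edges and `c a b d` of ordered
triples of vertices of a simplex, equal to `1` on degenerate edges and triples, with
`c b d a = p b a • c a b d`, `c a d b = (c a b d)⁻¹`, the boundary condition and the cocycle
condition for all quadruples of vertices of a simplex (`TotalLabelling`,
`MarkedFormalMap.toTotal`). The rotation rule says that transport to another vertex does not depend
on the path, by the Peiffer identity (`MarkedFormalMap.faceLabel_transport`). The cocycle condition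
is invariant under adjacent transpositions, so it passes from increasing quadruples to all of them
(`AbstractSimplicialComplex.forall_of_sorted`); the degenerate cases are trivial.

Conversely, a total labelling together with any vertex order and any start vertices is a marked
formal map (`TotalLabelling.toMarked`). Choosing new ones on `K` gives the relabelling
(`MarkedFormalMap.isRelabelling_toMarked`). Total labellings pull back along simplicial maps, also
degenerate ones; the pullback along the projection from a subdivided prism `K × I`, with an order
and start vertices that interpolate between the old and the new ones, is the required equivalence.
The edges over a vertex are collapsed by the projection, so they are labelled `1`.

The prism is subdivided by means of an arbitrary linear order on the vertices, unrelated to the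
vertex orders of the formal maps. A point at height `t` over `x` has its mass moved to the top from
the last vertex downwards until the mass `t` is reached; this gives a formula for the inverse of
the projection of the prism to `|K| × I` whose coordinates are visibly continuous
(`AbstractSimplicialComplex.upperPart`, `AbstractSimplicialComplex.prismHomeomorph`). As `K` need
not be locally finite, the product carries no evident weak topology; continuity of the inverse is
shown by currying (`AbstractSimplicialComplex.continuous_prismPoint`).
-/

/-! ### Triangles and orientations -/

namespace AbstractSimplicialComplex

variable {V W : Type*} {K : AbstractSimplicialComplex V}

theorem face_of_subset {σ τ : Finset V} (hσ : σ ∈ K.faces) (h : τ ⊆ σ) (hτ : τ.Nonempty) :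
    τ ∈ K.faces :=
  (K.isRelLowerSet_faces hσ).2 h hτ

theorem exists_simplex_one {σ : Finset V} (hσ : σ ∈ K.faces) {a b : V} (ha : a ∈ σ) (hb : b ∈ σ)
    (hab : a ≠ b) : ∃ e : K.Simplices 1, (e.1 : Set V) = {a, b} := by
  classical
  refine ⟨⟨{a, b}, face_of_subset hσ ?_ ⟨a, by simp⟩, Finset.card_pair hab⟩, by simp⟩
  simp [Finset.insert_subset_iff, *]

theorem exists_simplex_two {σ : Finset V} (hσ : σ ∈ K.faces) {a b d : V} (ha : a ∈ σ)
    (hb : b ∈ σ) (hd : d ∈ σ) (hab : a ≠ b) (hbd : b ≠ d) (had : a ≠ d) :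
    ∃ t : K.Simplices 2, (t.1 : Set V) = {a, b, d} := by
  classical
  refine ⟨⟨{a, b, d}, face_of_subset hσ ?_ ⟨a, by simp⟩, ?_⟩, by simp⟩
  · simp [Finset.insert_subset_iff, *]
  · exact Finset.card_eq_three.2 ⟨a, b, d, hab, had, hbd, rfl⟩

theorem exists_simplex_three {σ : Finset V} (hσ : σ ∈ K.faces) {a b d e : V} (ha : a ∈ σ)
    (hb : b ∈ σ) (hd : d ∈ σ) (he : e ∈ σ) (hab : a ≠ b) (had : a ≠ d) (hae : a ≠ e)
    (hbd : b ≠ d) (hbe : b ≠ e) (hde : d ≠ e) :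
    ∃ t : K.Simplices 3, (t.1 : Set V) = {a, b, d, e} := by
  classical
  refine ⟨⟨{a, b, d, e}, face_of_subset hσ ?_ ⟨a, by simp⟩, ?_⟩, by simp⟩
  · simp [Finset.insert_subset_iff, *]
  · simp [*]

namespace Simplices

theorem ext_coe {n : ℕ} {s t : K.Simplices n} (h : (s.1 : Set V) = t.1) : s = t :=
  Subtype.ext (Finset.coe_injective h)

theorem pair_ne {e : K.Simplices 1} {a b : V} (he : (e.1 : Set V) = {a, b}) : a ≠ b := by
  classical
  rintro rfl
  have h : e.1 = {a} := Finset.coe_injective (by simp [he])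
  have := e.2.2
  simp [h] at this

theorem triple_ne {t : K.Simplices 2} {a b d : V} (ht : (t.1 : Set V) = {a, b, d}) :
    a ≠ b ∧ b ≠ d ∧ a ≠ d := by
  classical
  have h : t.1 = {a, b, d} := Finset.coe_injective (by simp [ht])
  have h3 := t.2.2
  rw [h] at h3
  have h2 : ∀ x y : V, ({x, y} : Finset V).card ≤ 2 := fun _ _ => Finset.card_le_two
  refine ⟨?_, ?_, ?_⟩ <;> rintro rfl
  · have := h2 a d
    simp at h3; omega
  · have := h2 a b
    simp at h3; omega
  · have := h2 b a
    simp at h3; omega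

theorem mem_triple {t : K.Simplices 2} {a b d : V} (ht : (t.1 : Set V) = {a, b, d}) :
    a ∈ t.1 ∧ b ∈ t.1 ∧ d ∈ t.1 := by
  simp only [← Finset.mem_coe, ht]
  simp

theorem triple_rotate {t : K.Simplices 2} {a b d : V} (ht : (t.1 : Set V) = {a, b, d}) :
    (t.1 : Set V) = {b, d, a} := by
  rw [ht]; ext; simp; tauto

theorem triple_swap {t : K.Simplices 2} {a b d : V} (ht : (t.1 : Set V) = {a, b, d}) :
    (t.1 : Set V) = {a, d, b} := by
  rw [ht, Set.pair_comm]

end Simplices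

namespace VertexOrder

variable (o : VertexOrder K)

theorem lt_of_le_of_ne {a b : V} (h : o.Le a b) (hne : a ≠ b) : o.Lt a b :=
  letI := o.toPartialOrder
  _root_.lt_of_le_of_ne (α := V) h hne

theorem lt_asymm {a b : V} (h : o.Lt a b) : ¬ o.Lt b a := fun h' =>
  o.not_le_of_lt h (o.le_of_lt h')

theorem lt_or_lt {σ : Finset V} (hσ : σ ∈ K.faces) {a b : V} (ha : a ∈ σ) (hb : b ∈ σ)
    (hab : a ≠ b) : o.Lt a b ∨ o.Lt b a :=
  (o.total σ hσ a ha b hb).imp (o.lt_of_le_of_ne · hab) (o.lt_of_le_of_ne · hab.symm)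

variable {o}

theorem Cyclic.rotate {a b d : V} (h : o.Cyclic a b d) : o.Cyclic b d a := by
  unfold Cyclic at *; tauto

theorem Cyclic.not_swap {a b d : V} (h : o.Cyclic a b d) : ¬ o.Cyclic a d b := by
  have h1 := VertexOrder.lt_asymm o (a := a) (b := b)
  have h2 := VertexOrder.lt_asymm o (a := b) (b := d)
  have h3 := VertexOrder.lt_asymm o (a := d) (b := a)
  unfold Cyclic at *; tauto

variable (o)

theorem cyclic_or_swap {t : K.Simplices 2} {a b d : V} (ht : (t.1 : Set V) = {a, b, d}) :
    o.Cyclic a b d ∨ o.Cyclic a d b := by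
  obtain ⟨hab, hbd, had⟩ := Simplices.triple_ne ht
  obtain ⟨ha, hb, hd⟩ := Simplices.mem_triple ht
  have h1 := o.lt_or_lt t.2.1 ha hb hab
  have h2 := o.lt_or_lt t.2.1 hb hd hbd
  have h3 := o.lt_or_lt t.2.1 ha hd had
  unfold Cyclic; tauto

/-- Every triangle can be enumerated cyclically from any of its vertices. -/
theorem exists_cyclic (t : K.Simplices 2) {a : V} (ha : a ∈ t.1) :
    ∃ b d, (t.1 : Set V) = {a, b, d} ∧ o.Cyclic a b d := by
  classical
  obtain ⟨x, y, z, -, -, -, ht⟩ := Finset.card_eq_three.1 t.2.2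
  have ht' : (t.1 : Set V) = {x, y, z} := by simp [ht]
  have key : ∃ b d, (t.1 : Set V) = {a, b, d} := by
    rw [ht] at ha
    simp only [Finset.mem_insert, Finset.mem_singleton] at ha
    rcases ha with rfl | rfl | rfl
    · exact ⟨_, _, ht'⟩
    · exact ⟨_, _, Simplices.triple_rotate ht'⟩
    · exact ⟨_, _, Simplices.triple_rotate (Simplices.triple_rotate ht')⟩
  obtain ⟨b, d, h⟩ := key
  rcases o.cyclic_or_swap h with hc | hc
  · exact ⟨b, d, h, hc⟩
  · exact ⟨d, b, Simplices.triple_swap h, hc⟩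

variable {o}

theorem Cyclic.unique {t : K.Simplices 2} {a b d b' d' : V} (ht : (t.1 : Set V) = {a, b, d})
    (hc : o.Cyclic a b d) (ht' : (t.1 : Set V) = {a, b', d'}) (hc' : o.Cyclic a b' d') :
    b' = b ∧ d' = d := by
  obtain ⟨hab, hbd, had⟩ := Simplices.triple_ne ht
  obtain ⟨hab', hbd', had'⟩ := Simplices.triple_ne ht'
  obtain ⟨-, hb, hd⟩ := Simplices.mem_triple ht'
  simp only [← Finset.mem_coe, ht, Set.mem_insert_iff, Set.mem_singleton_iff] at hb hd
  rcases hb with rfl | rfl | rfl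
  · exact absurd rfl hab'
  · rcases hd with rfl | rfl | rfl
    · exact absurd rfl had'
    · exact absurd rfl hbd'
    · exact ⟨rfl, rfl⟩
  · rcases hd with rfl | rfl | rfl
    · exact absurd rfl had'
    · exact absurd hc hc'.not_swap
    · exact absurd rfl hbd'

end VertexOrder

/-- Two positively oriented enumerations of a triangle differ by a rotation. -/
theorem VertexOrder.Cyclic.eq_rotation {o : VertexOrder K} {t : K.Simplices 2} {a b d a' b' d' : V}
    (ht : (t.1 : Set V) = {a, b, d}) (hc : o.Cyclic a b d) (ht' : (t.1 : Set V) = {a', b', d'})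
    (hc' : o.Cyclic a' b' d') : (a' = a ∧ b' = b ∧ d' = d) ∨ (a' = b ∧ b' = d ∧ d' = a) ∨
      (a' = d ∧ b' = a ∧ d' = b) := by
  have h := (Simplices.mem_triple ht').1
  have ht1 := Simplices.triple_rotate ht
  have ht2 := Simplices.triple_rotate ht1
  simp only [← Finset.mem_coe, ht, Set.mem_insert_iff, Set.mem_singleton_iff] at h
  rcases h with rfl | rfl | rfl
  · exact Or.inl ⟨rfl, unique ht hc ht' hc'⟩
  · exact Or.inr (Or.inl ⟨rfl, unique ht1 hc.rotate ht' hc'⟩)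
  · exact Or.inr (Or.inr ⟨rfl, unique ht2 hc.rotate.rotate ht' hc'⟩)

/-- A predicate on quadruples that is invariant under the three adjacent transpositions and holds on
the increasing quadruples for a total relation holds on all quadruples. -/
theorem forall_of_sorted {α : Type*} (r : α → α → Prop) (hr : ∀ a b, r a b ∨ r b a)
    (Q : α → α → α → α → Prop) (h12 : ∀ a b d e, Q b a d e → Q a b d e)
    (h23 : ∀ a b d e, Q a d b e → Q a b d e) (h34 : ∀ a b d e, Q a b e d → Q a b d e)
    (h : ∀ a b d e, r a b → r b d → r d e → Q a b d e) (a b d e : α) : Q a b d e := by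
  have h3 : ∀ a b d e, r a b → r b d → Q a b d e := by
    intro a b d e hab hbd
    rcases hr d e with hde | hed
    · exact h _ _ _ _ hab hbd hde
    apply h34
    rcases hr b e with hbe | heb
    · exact h _ _ _ _ hab hbe hed
    apply h23
    rcases hr a e with hae | hea
    · exact h _ _ _ _ hae heb hbd
    · exact h12 _ _ _ _ (h _ _ _ _ hea hab hbd)
  have h2 : ∀ a b d e, r a b → Q a b d e := by
    intro a b d e hab
    rcases hr b d with hbd | hdb
    · exact h3 _ _ _ _ hab hbd
    apply h23
    rcases hr a d with had | hda
    · exact h3 _ _ _ _ had hdb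
    · exact h12 _ _ _ _ (h3 _ _ _ _ hda hab)
  rcases hr a b with hab | hba
  · exact h2 _ _ _ _ hab
  · exact h12 _ _ _ _ (h2 _ _ _ _ hba)

end AbstractSimplicialComplex

/-! ### Edge labels -/

section EdgeLabels

open AbstractSimplicialComplex

variable {C P : Type*} [Group C] [Group P] [MulDistribMulAction P C] {𝒞 : CrossedModule C P}
  {V : Type*} {K : AbstractSimplicialComplex V} (s : StartVertices K) (p : K.Simplices 1 → P)

theorem start_eq_or_eq {u v : V} {e : K.Simplices 1} (he : (e.1 : Set V) = {u, v}) :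
    s.start e.toFace = u ∨ s.start e.toFace = v := by
  have h : s.start e.toFace ∈ (e.1 : Set V) := s.start_mem e.toFace
  simpa [he] using h

open Classical in
theorem edgeLabel_eq_ite {u v : V} {e : K.Simplices 1} (he : (e.1 : Set V) = {u, v}) :
    edgeLabel s p u v = if s.start e.toFace = u then p e else (p e)⁻¹ := by
  have he' : e.1 = {u, v} := Finset.coe_injective (by simp [he])
  obtain ⟨e, hK, hc⟩ := e
  subst he'
  exact dif_pos (⟨hK, hc⟩ : _ ∧ _)

theorem edgeLabel_of_start {u v : V} {e : K.Simplices 1} (he : (e.1 : Set V) = {u, v})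
    (hs : s.start e.toFace = u) : edgeLabel s p u v = p e := by
  rw [edgeLabel_eq_ite s p he, if_pos hs]

theorem edgeLabel_eq_one {u v : V} (h : ¬ ∃ e : K.Simplices 1, (e.1 : Set V) = {u, v}) :
    edgeLabel s p u v = 1 := by
  classical
  exact dif_neg fun h' => h ⟨⟨_, h'⟩, by simp⟩

theorem edgeLabel_symm (u v : V) : edgeLabel s p v u = (edgeLabel s p u v)⁻¹ := by
  classical
  by_cases h : ∃ e : K.Simplices 1, (e.1 : Set V) = {u, v}
  · obtain ⟨e, he⟩ := h
    have hne := Simplices.pair_ne he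
    rw [edgeLabel_eq_ite s p he, edgeLabel_eq_ite s p (he.trans (Set.pair_comm u v))]
    rcases start_eq_or_eq s he with h | h <;> simp [h, hne, hne.symm]
  · rw [edgeLabel_eq_one s p h, edgeLabel_eq_one s p (by rwa [Set.pair_comm]), inv_one]

end EdgeLabels

/-! ### Total labellings -/

open AbstractSimplicialComplex in
/-- A labelling of all directed edges and all ordered triples of vertices of the simplices of `K`
(repetitions allowed) that makes no reference to a vertex order or to start vertices: `p u v` is
the label of the path from `u` to `v`, and `c a b d` is the label of the triangle `abd`, oriented as
written and based at its first vertex. -/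
structure TotalLabelling {C P : Type*} [Group C] [Group P] [MulDistribMulAction P C]
    (𝒞 : CrossedModule C P) {V : Type*} (K : AbstractSimplicialComplex V) where
  p : V → V → P
  c : V → V → V → C
  p_self : ∀ u, p u u = 1
  p_symm : ∀ u v, p v u = (p u v)⁻¹
  boundary : ∀ σ ∈ K.faces, ∀ a ∈ σ, ∀ b ∈ σ, ∀ d ∈ σ, 𝒞.bd (c a b d) = p a d * p d b * p b a
  rotate : ∀ σ ∈ K.faces, ∀ a ∈ σ, ∀ b ∈ σ, ∀ d ∈ σ, c b d a = p b a • c a b d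
  swap : ∀ a b d, c a d b = (c a b d)⁻¹
  cocycle : ∀ σ ∈ K.faces, ∀ a ∈ σ, ∀ b ∈ σ, ∀ d ∈ σ, ∀ e ∈ σ,
    c a b e * p a b • c b d e = c a d e * c a b d

section OfMarked

open AbstractSimplicialComplex

variable {C P : Type*} [Group C] [Group P] [MulDistribMulAction P C] {𝒞 : CrossedModule C P}
  {V : Type*} {K : AbstractSimplicialComplex V} (lam : MarkedFormalMap 𝒞 K)

namespace MarkedFormalMap

/-- The label of the path from `u` to `v`. -/
noncomputable abbrev pathLabel (u v : V) : P := edgeLabel lam.starts lam.p u v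

open Classical in
/-- The label of the triangle `abd`, transported to its vertex `a` and inverted if the orientation
given by the vertex order is not that of `(a, b, d)`. It is `1` if `a`, `b`, `d` do not span a
triangle, in particular if two of them coincide. -/
noncomputable def tripleLabel (a b d : V) : C :=
  if h : ∃ t : K.Simplices 2, (t.1 : Set V) = {a, b, d} then
    if lam.order.Cyclic a b d then faceLabel lam.starts lam.p lam.c a h.choose
    else (faceLabel lam.starts lam.p lam.c a h.choose)⁻¹
  else 1

variable {lam} {t : K.Simplices 2} {a b d : V}

theorem tripleLabel_of_cyclic (ht : (t.1 : Set V) = {a, b, d}) (hc : lam.order.Cyclic a b d) :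
    lam.tripleLabel a b d = faceLabel lam.starts lam.p lam.c a t := by
  have h : ∃ t : K.Simplices 2, (t.1 : Set V) = {a, b, d} := ⟨t, ht⟩
  have h' : h.choose = t := Simplices.ext_coe (h.choose_spec.trans ht.symm)
  rw [tripleLabel, dif_pos h, if_pos hc, h']

theorem tripleLabel_of_cyclic_swap (ht : (t.1 : Set V) = {a, b, d})
    (hc : lam.order.Cyclic a d b) :
    lam.tripleLabel a b d = (faceLabel lam.starts lam.p lam.c a t)⁻¹ := by
  have h : ∃ t : K.Simplices 2, (t.1 : Set V) = {a, b, d} := ⟨t, ht⟩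
  have h' : h.choose = t := Simplices.ext_coe (h.choose_spec.trans ht.symm)
  rw [tripleLabel, dif_pos h, if_neg hc.not_swap, h']

variable (lam)

theorem tripleLabel_eq_one (h : ¬ ∃ t : K.Simplices 2, (t.1 : Set V) = {a, b, d}) :
    lam.tripleLabel a b d = 1 :=
  dif_neg h

theorem tripleLabel_self_left (a d : V) : lam.tripleLabel a a d = 1 :=
  lam.tripleLabel_eq_one fun ⟨_, h⟩ => (Simplices.triple_ne h).1 rfl

theorem tripleLabel_self_right (a b : V) : lam.tripleLabel a b b = 1 :=
  lam.tripleLabel_eq_one fun ⟨_, h⟩ => (Simplices.triple_ne h).2.1 rfl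

theorem tripleLabel_swap (a b d : V) : lam.tripleLabel a d b = (lam.tripleLabel a b d)⁻¹ := by
  by_cases h : ∃ t : K.Simplices 2, (t.1 : Set V) = {a, b, d}
  · obtain ⟨t, ht⟩ := h
    rcases lam.order.cyclic_or_swap ht with hc | hc
    · rw [tripleLabel_of_cyclic ht hc,
        tripleLabel_of_cyclic_swap (Simplices.triple_swap ht) hc]
    · rw [tripleLabel_of_cyclic_swap ht hc,
        tripleLabel_of_cyclic (Simplices.triple_swap ht) hc, inv_inv]
  · rw [tripleLabel_eq_one lam h, tripleLabel_eq_one lam (by rwa [Set.pair_comm]), inv_one]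

variable {lam}

/-- Transporting the label of a triangle along its edges does not depend on the path: two paths
differ by the boundary of the triangle, which acts trivially on its label by the Peiffer
identity. -/
theorem faceLabel_transport (ht : (t.1 : Set V) = {a, b, d}) :
    faceLabel lam.starts lam.p lam.c b t =
      lam.pathLabel b a • faceLabel lam.starts lam.p lam.c a t := by
  have hs : lam.starts.start t.toFace ∈ (t.1 : Set V) := lam.starts.start_mem t.toFace
  simp only [ht, Set.mem_insert_iff, Set.mem_singleton_iff] at hs
  have hpf : 𝒞.bd (lam.c t) • lam.c t = lam.c t := by
    rw [𝒞.peiffer, mul_inv_cancel_right]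
  simp only [faceLabel, smul_smul, pathLabel]
  rcases hs with h | h | h
  · rw [h, edgeLabel_self, mul_one]
  · rw [h, edgeLabel_self, edgeLabel_symm lam.starts lam.p b a, mul_inv_cancel]
  · rw [h]
    rcases lam.order.cyclic_or_swap ht with hc | hc
    · have hb := lam.boundary t d a b (Simplices.triple_rotate (Simplices.triple_rotate ht))
        hc.rotate.rotate h
      conv_lhs => rw [← hpf]
      rw [hb, smul_smul]
      congr 1
      rw [edgeLabel_symm lam.starts lam.p b d]
      group
    · have hb := lam.boundary t d b a (Simplices.triple_rotate (Simplices.triple_swap ht))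
        hc.rotate h
      conv_rhs => rw [← hpf]
      rw [hb, smul_smul]
      congr 1
      rw [edgeLabel_symm lam.starts lam.p d a, edgeLabel_symm lam.starts lam.p b a]
      group

theorem bd_faceLabel (ht : (t.1 : Set V) = {a, b, d}) (hc : lam.order.Cyclic a b d) :
    𝒞.bd (faceLabel lam.starts lam.p lam.c a t) =
      lam.pathLabel a d * lam.pathLabel d b * lam.pathLabel b a := by
  have hs : lam.starts.start t.toFace ∈ (t.1 : Set V) := lam.starts.start_mem t.toFace
  simp only [ht, Set.mem_insert_iff, Set.mem_singleton_iff] at hs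
  have ht' := Simplices.triple_rotate ht
  simp only [faceLabel, 𝒞.bd_smul, pathLabel]
  rcases hs with h | h | h
  · rw [h, lam.boundary t a b d ht hc h, edgeLabel_self]
    group
  · rw [h, lam.boundary t b d a ht' hc.rotate h, edgeLabel_symm lam.starts lam.p b a]
    group
  · rw [h, lam.boundary t d a b (Simplices.triple_rotate ht') hc.rotate.rotate h,
      edgeLabel_symm lam.starts lam.p d a]
    group

variable (lam)

theorem tripleLabel_rotate (a b d : V) :
    lam.tripleLabel b d a = lam.pathLabel b a • lam.tripleLabel a b d := by
  by_cases h : ∃ t : K.Simplices 2, (t.1 : Set V) = {a, b, d}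
  · obtain ⟨t, ht⟩ := h
    have ht' := Simplices.triple_rotate ht
    rcases lam.order.cyclic_or_swap ht with hc | hc
    · rw [tripleLabel_of_cyclic ht hc, tripleLabel_of_cyclic ht' hc.rotate,
        faceLabel_transport ht]
    · rw [tripleLabel_of_cyclic_swap ht hc, tripleLabel_of_cyclic_swap ht' hc.rotate.rotate,
        faceLabel_transport ht, smul_inv']
  · have h' : ¬ ∃ t : K.Simplices 2, (t.1 : Set V) = {b, d, a} := fun ⟨t, ht⟩ =>
      h ⟨t, Simplices.triple_rotate (Simplices.triple_rotate ht)⟩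
    rw [tripleLabel_eq_one lam h, tripleLabel_eq_one lam h', smul_one]

theorem bd_tripleLabel {σ : Finset V} (hσ : σ ∈ K.faces) (ha : a ∈ σ) (hb : b ∈ σ) (hd : d ∈ σ) :
    𝒞.bd (lam.tripleLabel a b d) =
      lam.pathLabel a d * lam.pathLabel d b * lam.pathLabel b a := by
  by_cases h : ∃ t : K.Simplices 2, (t.1 : Set V) = {a, b, d}
  · obtain ⟨t, ht⟩ := h
    rcases lam.order.cyclic_or_swap ht with hc | hc
    · rw [tripleLabel_of_cyclic ht hc, bd_faceLabel ht hc]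
    · rw [tripleLabel_of_cyclic_swap ht hc, map_inv, bd_faceLabel (Simplices.triple_swap ht) hc]
      simp only [pathLabel, edgeLabel_symm lam.starts lam.p a b,
        edgeLabel_symm lam.starts lam.p a d, edgeLabel_symm lam.starts lam.p b d]
      group
  · rw [tripleLabel_eq_one lam h, map_one]
    simp only [pathLabel]
    by_cases hab : a = b
    · subst hab
      rw [edgeLabel_symm lam.starts lam.p a d, edgeLabel_self]
      group
    by_cases hbd : b = d
    · subst hbd
      rw [edgeLabel_symm lam.starts lam.p a b, edgeLabel_self]
      group
    by_cases had : a = d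
    · subst had
      rw [edgeLabel_symm lam.starts lam.p a b, edgeLabel_self]
      group
    exact absurd (exists_simplex_two hσ ha hb hd hab hbd had) h

/-- The cocycle condition for an increasing quadruple, possibly with repetitions. -/
theorem tripleLabel_cocycle_of_le {σ : Finset V} (hσ : σ ∈ K.faces) {e : V} (ha : a ∈ σ)
    (hb : b ∈ σ) (hd : d ∈ σ) (he : e ∈ σ) (hab : lam.order.Le a b) (hbd : lam.order.Le b d)
    (hde : lam.order.Le d e) :
    lam.tripleLabel a b e * lam.pathLabel a b • lam.tripleLabel b d e =
      lam.tripleLabel a d e * lam.tripleLabel a b d := by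
  by_cases h1 : a = b
  · subst h1
    simp [tripleLabel_self_left, pathLabel, edgeLabel_self]
  by_cases h2 : b = d
  · subst h2
    simp [tripleLabel_self_left, tripleLabel_self_right]
  by_cases h3 : d = e
  · subst h3
    simp [tripleLabel_self_right]
  have l01 := lam.order.lt_of_le_of_ne hab h1
  have l12 := lam.order.lt_of_le_of_ne hbd h2
  have l23 := lam.order.lt_of_le_of_ne hde h3
  have l02 := lam.order.lt_trans l01 l12
  have l13 := lam.order.lt_trans l12 l23
  have l03 := lam.order.lt_trans l01 l13
  have n02 := lam.order.ne_of_lt l02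
  have n13 := lam.order.ne_of_lt l13
  have n03 := lam.order.ne_of_lt l03
  obtain ⟨s, hs⟩ := exists_simplex_three hσ ha hb hd he h1 n02 n03 h2 n13 h3
  obtain ⟨t0, ht0⟩ := exists_simplex_two hσ hb hd he h2 h3 n13
  obtain ⟨t1, ht1⟩ := exists_simplex_two hσ ha hd he n02 h3 n03
  obtain ⟨t2, ht2⟩ := exists_simplex_two hσ ha hb he h1 n13 n03
  obtain ⟨t3, ht3⟩ := exists_simplex_two hσ ha hb hd h1 h2 n02
  rw [tripleLabel_of_cyclic ht0 (Or.inl ⟨l12, l23⟩), tripleLabel_of_cyclic ht1 (Or.inl ⟨l02, l23⟩),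
    tripleLabel_of_cyclic ht2 (Or.inl ⟨l01, l13⟩), tripleLabel_of_cyclic ht3 (Or.inl ⟨l01, l12⟩)]
  exact smul_left_cancel _ (lam.cocycle a b d e l01 l12 l23 s t0 t1 t2 t3 hs ht0 ht1 ht2 ht3)

/-- The total labelling given by a marked formal map. The cocycle condition for an arbitrary
quadruple is reduced to that of increasing quadruples by adjacent transpositions, each of which
only rearranges the equation. -/
noncomputable def toTotal : TotalLabelling 𝒞 K where
  p := lam.pathLabel
  c := lam.tripleLabel
  p_self := edgeLabel_self lam.starts lam.p
  p_symm := edgeLabel_symm lam.starts lam.p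
  boundary _ hσ _ ha _ hb _ hd := lam.bd_tripleLabel hσ ha hb hd
  rotate _ _ a _ b _ d _ := lam.tripleLabel_rotate a b d
  swap := lam.tripleLabel_swap
  cocycle := by
    intro σ hσ a ha b hb d hd e he
    -- The label of a triangle at its first vertex, in terms of the labels at its second vertex.
    have unrot : ∀ x y z, lam.pathLabel x y • lam.tripleLabel y z x = lam.tripleLabel x y z := by
      intro x y z
      rw [lam.tripleLabel_rotate x y z, smul_smul, pathLabel, pathLabel,
        edgeLabel_symm lam.starts lam.p y x, inv_mul_cancel, one_smul]
    refine forall_of_sorted (α := {v // v ∈ σ}) (fun a b => lam.order.Le a.1 b.1)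
      (fun a b => lam.order.total σ hσ _ a.2 _ b.2)
      (fun a b d e => lam.tripleLabel a b e * lam.pathLabel a b • lam.tripleLabel b d e =
        lam.tripleLabel a d e * lam.tripleLabel a b d) ?_ ?_ ?_
      (fun a b d e => lam.tripleLabel_cocycle_of_le hσ a.2 b.2 d.2 e.2) ⟨a, ha⟩ ⟨b, hb⟩ ⟨d, hd⟩
      ⟨e, he⟩
    · rintro ⟨a, _⟩ ⟨b, _⟩ ⟨d, _⟩ ⟨e, _⟩ h
      have h' := congrArg (lam.pathLabel a b • ·) h
      dsimp only at h' ⊢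
      have hp : lam.pathLabel a b * lam.pathLabel b a = 1 := by
        simp only [pathLabel, edgeLabel_symm lam.starts lam.p a b, mul_inv_cancel]
      rw [smul_mul', smul_mul', lam.tripleLabel_swap b e a, lam.tripleLabel_swap b d a, smul_inv',
        smul_inv', unrot, unrot, smul_smul, hp, one_smul, inv_mul_eq_iff_eq_mul] at h'
      rw [h']
      group
    · rintro ⟨a, ha⟩ ⟨b, hb⟩ ⟨d, hd⟩ ⟨e, _⟩ h
      dsimp only at h ⊢
      have hp : lam.pathLabel a d * lam.pathLabel d b =
          𝒞.bd (lam.tripleLabel a b d) * lam.pathLabel a b := by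
        rw [lam.bd_tripleLabel hσ ha hb hd]
        simp only [pathLabel, edgeLabel_symm lam.starts lam.p a b]
        group
      rw [lam.tripleLabel_swap d e b, lam.tripleLabel_rotate b d e, lam.tripleLabel_swap a b d,
        smul_inv', smul_smul, hp, mul_smul, 𝒞.peiffer] at h
      rw [← mul_inv_eq_iff_eq_mul, inv_inv] at h
      rw [← h]
      group
    · rintro ⟨a, _⟩ ⟨b, _⟩ ⟨d, _⟩ ⟨e, _⟩ h
      dsimp only at h ⊢
      rw [lam.tripleLabel_swap b d e, lam.tripleLabel_swap a d e, smul_inv',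
        eq_inv_mul_iff_mul_eq] at h
      rw [← h]
      group

end MarkedFormalMap

end OfMarked

/-! ### Marked formal maps from total labellings -/

section ToMarked

open AbstractSimplicialComplex

variable {C P : Type*} [Group C] [Group P] [MulDistribMulAction P C] {𝒞 : CrossedModule C P}
  {V W : Type*} {K : AbstractSimplicialComplex V} {L : AbstractSimplicialComplex W}

namespace TotalLabelling

/-- The pullback of a total labelling along a simplicial map, which may collapse simplices. -/
def pullback (l : TotalLabelling 𝒞 K) (f : W → V)
    (hf : ∀ σ ∈ L.faces, ∃ τ ∈ K.faces, ∀ v ∈ σ, f v ∈ τ) : TotalLabelling 𝒞 L where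
  p u v := l.p (f u) (f v)
  c a b d := l.c (f a) (f b) (f d)
  p_self _ := l.p_self _
  p_symm _ _ := l.p_symm _ _
  boundary σ hσ a ha b hb d hd := by
    obtain ⟨τ, hτ, h⟩ := hf σ hσ
    exact l.boundary τ hτ _ (h a ha) _ (h b hb) _ (h d hd)
  rotate σ hσ a ha b hb d hd := by
    obtain ⟨τ, hτ, h⟩ := hf σ hσ
    exact l.rotate τ hτ _ (h a ha) _ (h b hb) _ (h d hd)
  swap _ _ _ := l.swap _ _ _
  cocycle σ hσ a ha b hb d hd e he := by
    obtain ⟨τ, hτ, h⟩ := hf σ hσ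
    exact l.cocycle τ hτ _ (h a ha) _ (h b hb) _ (h d hd) _ (h e he)

theorem exists_end (s : StartVertices K) (e : K.Simplices 1) :
    ∃ b, (e.1 : Set V) = {s.start e.toFace, b} := by
  classical
  obtain ⟨x, y, -, h⟩ := Finset.card_eq_two.1 e.2.2
  have he : (e.1 : Set V) = {x, y} := by simp [h]
  rcases start_eq_or_eq s he with h | h
  · exact ⟨y, by rw [h, he]⟩
  · exact ⟨x, by rw [h, he, Set.pair_comm]⟩

variable (l : TotalLabelling 𝒞 K) (o : VertexOrder K) (s : StartVertices K)

/-- The label of an edge in the direction away from its start vertex. -/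
noncomputable def edge (e : K.Simplices 1) : P :=
  l.p (s.start e.toFace) (exists_end s e).choose

/-- The label of a triangle with the orientation given by the order, based at its start vertex. -/
noncomputable def face (t : K.Simplices 2) : C :=
  l.c (s.start t.toFace) (o.exists_cyclic t (s.start_mem t.toFace)).choose
    (o.exists_cyclic t (s.start_mem t.toFace)).choose_spec.choose

variable {o s}

theorem edge_eq {e : K.Simplices 1} {a b : V} (he : (e.1 : Set V) = {a, b})
    (ha : s.start e.toFace = a) : l.edge s e = l.p a b := by
  subst ha
  obtain ⟨c, hc⟩ : ∃ c, (exists_end s e).choose = c := ⟨_, rfl⟩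
  have h : (e.1 : Set V) = {s.start e.toFace, c} := hc ▸ (exists_end s e).choose_spec
  have h2 : c ∈ (e.1 : Set V) := by rw [h]; simp
  rw [he] at h2
  rw [edge, hc, h2.resolve_left (Simplices.pair_ne h).symm]

theorem face_eq {t : K.Simplices 2} {a b d : V} (ht : (t.1 : Set V) = {a, b, d})
    (hc : o.Cyclic a b d) (ha : s.start t.toFace = a) : l.face o s t = l.c a b d := by
  subst ha
  have h := (o.exists_cyclic t (s.start_mem t.toFace)).choose_spec.choose_spec
  obtain ⟨h1, h2⟩ := VertexOrder.Cyclic.unique ht hc h.1 h.2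
  rw [face, h2, h1]

theorem edgeLabel_edge_of_simplex {e : K.Simplices 1} {u v : V} (he : (e.1 : Set V) = {u, v}) :
    edgeLabel s (l.edge s) u v = l.p u v := by
  rcases start_eq_or_eq s he with h | h
  · rw [edgeLabel_of_start s _ he h, l.edge_eq he h]
  · have he' := he.trans (Set.pair_comm u v)
    rw [edgeLabel_symm, edgeLabel_of_start s _ he' h, l.edge_eq he' h, ← l.p_symm]

theorem edgeLabel_edge {σ : Finset V} (hσ : σ ∈ K.faces) {u v : V} (hu : u ∈ σ) (hv : v ∈ σ) :
    edgeLabel s (l.edge s) u v = l.p u v := by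
  by_cases huv : u = v
  · subst huv
    rw [edgeLabel_self, l.p_self]
  · obtain ⟨e, he⟩ := exists_simplex_one hσ hu hv huv
    exact l.edgeLabel_edge_of_simplex he

theorem faceLabel_face {t : K.Simplices 2} {a b d : V} (ht : (t.1 : Set V) = {a, b, d})
    (hc : o.Cyclic a b d) : faceLabel s (l.edge s) (l.face o s) a t = l.c a b d := by
  have hs : s.start t.toFace ∈ (t.1 : Set V) := s.start_mem t.toFace
  simp only [ht, Set.mem_insert_iff, Set.mem_singleton_iff] at hs
  obtain ⟨ha, hb, hd⟩ := Simplices.mem_triple ht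
  have ht' := Simplices.triple_rotate ht
  have ht'' := Simplices.triple_rotate ht'
  rw [faceLabel]
  rcases hs with h | h | h
  · rw [l.face_eq ht hc h, h, edgeLabel_self, one_smul]
  · rw [l.face_eq ht' hc.rotate h, h, l.edgeLabel_edge t.2.1 ha hb,
      l.rotate _ t.2.1 a ha b hb d hd, smul_smul, l.p_symm b a, inv_mul_cancel, one_smul]
  · rw [l.face_eq ht'' hc.rotate.rotate h, h, l.edgeLabel_edge t.2.1 ha hd,
      ← l.rotate _ t.2.1 d hd a ha b hb]

variable (o s)

/-- The marked formal map with prescribed vertex order and start vertices whose labels are read off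
from a total labelling. -/
noncomputable def toMarked : MarkedFormalMap 𝒞 K where
  order := o
  starts := s
  p := l.edge s
  c := l.face o s
  boundary t a b d ht hc h := by
    obtain ⟨ha, hb, hd⟩ := Simplices.mem_triple ht
    rw [l.face_eq ht hc h, l.boundary _ t.2.1 a ha b hb d hd, l.edgeLabel_edge t.2.1 ha hd,
      l.edgeLabel_edge t.2.1 hd hb, l.edgeLabel_edge t.2.1 hb ha]
  cocycle v0 v1 v2 v3 h01 h12 h23 σ t0 t1 t2 t3 hσ ht0 ht1 ht2 ht3 := by
    have hmem : ∀ w, w ∈ σ.1 ↔ w = v0 ∨ w = v1 ∨ w = v2 ∨ w = v3 := fun w => by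
      rw [← Finset.mem_coe, hσ]
      simp
    have m0 := (hmem v0).2 (by simp)
    have m1 := (hmem v1).2 (by simp)
    have m2 := (hmem v2).2 (by simp)
    have m3 := (hmem v3).2 (by simp)
    have h02 := o.lt_trans h01 h12
    have h13 := o.lt_trans h12 h23
    rw [l.faceLabel_face ht0 (Or.inl ⟨h12, h23⟩), l.faceLabel_face ht1 (Or.inl ⟨h02, h23⟩),
      l.faceLabel_face ht2 (Or.inl ⟨h01, h13⟩), l.faceLabel_face ht3 (Or.inl ⟨h01, h12⟩),
      l.edgeLabel_edge σ.2.1 m0 m1, l.cocycle σ.1 σ.2.1 v0 m0 v1 m1 v2 m2 v3 m3]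

end TotalLabelling

theorem MarkedFormalMap.toMarked_toTotal (lam : MarkedFormalMap 𝒞 K) :
    lam.toTotal.toMarked lam.order lam.starts = lam := by
  have hp : lam.toTotal.edge lam.starts = lam.p := by
    funext e
    obtain ⟨b, he⟩ := TotalLabelling.exists_end lam.starts e
    rw [lam.toTotal.edge_eq he rfl]
    exact edgeLabel_of_start _ _ he rfl
  have hc : lam.toTotal.face lam.order lam.starts = lam.c := by
    funext t
    obtain ⟨b, d, ht, hc⟩ := lam.order.exists_cyclic t (lam.starts.start_mem t.toFace)
    rw [lam.toTotal.face_eq ht hc rfl]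
    refine (tripleLabel_of_cyclic ht hc).trans ?_
    rw [faceLabel, edgeLabel_self, one_smul]
  cases lam
  simp only [TotalLabelling.toMarked, MarkedFormalMap.mk.injEq, true_and]
  exact ⟨hp, hc⟩

theorem MarkedFormalMap.isRelabelling_toMarked (lam : MarkedFormalMap 𝒞 K) (o : VertexOrder K)
    (s : StartVertices K) : lam.IsRelabelling (lam.toTotal.toMarked o s) where
  edge u v := by
    change edgeLabel s (lam.toTotal.edge s) u v = _
    by_cases h : ∃ e : K.Simplices 1, (e.1 : Set V) = {u, v}
    · obtain ⟨e, he⟩ := h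
      exact lam.toTotal.edgeLabel_edge_of_simplex he
    · rw [edgeLabel_eq_one _ _ h, edgeLabel_eq_one _ _ h]
  face_same t a b d ht hc hc' := by
    obtain ⟨b', d', ht', h'⟩ := o.exists_cyclic t (s.start_mem t.toFace)
    refine (lam.toTotal.face_eq ht' h' rfl).trans (tripleLabel_of_cyclic ht' ?_)
    rcases VertexOrder.Cyclic.eq_rotation ht hc' ht' h' with ⟨h1, h2, h3⟩ | ⟨h1, h2, h3⟩ |
      ⟨h1, h2, h3⟩ <;> rw [h1, h2, h3]
    exacts [hc, hc.rotate, hc.rotate.rotate]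
  face_opposite t a b d ht hc hc' := by
    obtain ⟨b', d', ht', h'⟩ := o.exists_cyclic t (s.start_mem t.toFace)
    refine (lam.toTotal.face_eq ht' h' rfl).trans (tripleLabel_of_cyclic_swap ht' ?_)
    rcases VertexOrder.Cyclic.eq_rotation (Simplices.triple_swap ht) hc' ht' h' with
      ⟨h1, h2, h3⟩ | ⟨h1, h2, h3⟩ | ⟨h1, h2, h3⟩ <;> rw [h1, h2, h3]
    exacts [hc, hc.rotate.rotate, hc.rotate]

/-- If a total labelling of `L` restricts along an embedding of `K` to a total labelling of `K`,
and if the orders and the start vertices restrict, then so do the marked formal maps. -/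
theorem TotalLabelling.extends_toMarked {l : TotalLabelling 𝒞 L} {l' : TotalLabelling 𝒞 K}
    (i : Embedding K L) (hp : ∀ u v, l.p (i.toEmbedding u) (i.toEmbedding v) = l'.p u v)
    (hc : ∀ a b d, l.c (i.toEmbedding a) (i.toEmbedding b) (i.toEmbedding d) = l'.c a b d)
    {o : VertexOrder L} {o' : VertexOrder K} {s : StartVertices L} {s' : StartVertices K}
    (ho : ∀ u v : V, o.Le (i.toEmbedding u) (i.toEmbedding v) ↔ o'.Le u v)
    (hs : ∀ σ : K.faces, s.start (i.mapFace σ) = i.toEmbedding (s'.start σ)) :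
    (l.toMarked o s).Extends i (l'.toMarked o' s') where
  order := ho
  starts := hs
  p e := by
    obtain ⟨b, he⟩ := exists_end s' e
    refine (l.edge_eq (a := i.toEmbedding (s'.start e.toFace)) (b := i.toEmbedding b) ?_
      (hs e.toFace)).trans ((hp _ _).trans (l'.edge_eq he rfl).symm)
    rw [Embedding.mapSimplex, Finset.coe_map, he, Set.image_pair]
  c t := by
    obtain ⟨b, d, ht, h⟩ := o'.exists_cyclic t (s'.start_mem t.toFace)
    have hlt : ∀ {u v}, o'.Lt u v → o.Lt (i.toEmbedding u) (i.toEmbedding v) := fun {u v} huv =>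
      o.lt_of_le_of_ne ((ho u v).2 (o'.le_of_lt huv))
        (i.toEmbedding.injective.ne (o'.ne_of_lt huv))
    refine (l.face_eq (a := i.toEmbedding (s'.start t.toFace)) (b := i.toEmbedding b)
      (d := i.toEmbedding d) ?_ ?_ (hs t.toFace)).trans ((hc _ _ _).trans (l'.face_eq ht h rfl).symm)
    · rw [Embedding.mapSimplex, Finset.coe_map, ht, Set.image_insert_eq, Set.image_pair]
    · exact h.imp (fun h => ⟨hlt h.1, hlt h.2⟩)
        (Or.imp (fun h => ⟨hlt h.1, hlt h.2⟩) (fun h => ⟨hlt h.1, hlt h.2⟩))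

theorem AbstractSimplicialComplex.VertexOrder.firstVertices_mapFace (i : Embedding K L)
    {o : VertexOrder L} {o' : VertexOrder K}
    (ho : ∀ u v : V, o.Le (i.toEmbedding u) (i.toEmbedding v) ↔ o'.Le u v) (σ : K.faces) :
    o.firstVertices.start (i.mapFace σ) = i.toEmbedding (o'.firstVertices.start σ) := by
  obtain ⟨v, hv, h⟩ := o'.exists_first σ
  rw [o'.firstVertices_eq σ hv h]
  refine o.firstVertices_eq _ (Finset.mem_map_of_mem _ hv) fun w hw => ?_
  obtain ⟨u, hu, rfl⟩ := Finset.mem_map.1 hw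
  exact (ho _ _).2 (h u hu)

theorem AbstractSimplicialComplex.VertexOrder.firstVertices_triple (o : VertexOrder K)
    {t : K.Simplices 2} {a b d : V} (ht : (t.1 : Set V) = {a, b, d}) (hab : o.Lt a b)
    (hbd : o.Lt b d) : o.firstVertices.start t.toFace = a := by
  refine o.firstVertices_eq _ (Simplices.mem_triple ht).1 fun w hw => ?_
  have hw' : w ∈ (t.1 : Set V) := hw
  rw [ht] at hw'
  rcases hw' with rfl | rfl | rfl
  · exact o.le_refl _
  · exact o.le_of_lt hab
  · exact o.le_of_lt (o.lt_trans hab hbd)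

/-- A marked formal map whose start vertices are the first vertices is a formal map. -/
noncomputable def FormalMap.ofMarked (lam : MarkedFormalMap 𝒞 K)
    (h : lam.starts = lam.order.firstVertices) : FormalMap 𝒞 K where
  order := lam.order
  p := lam.p
  c := lam.c
  boundary v0 v1 v2 h01 h12 t e0 e1 e2 ht he0 he1 he2 := by
    have h02 := lam.order.lt_trans h01 h12
    rw [lam.boundary t v0 v1 v2 ht (Or.inl ⟨h01, h12⟩)
        (by rw [h, lam.order.firstVertices_triple ht h01 h12]), h,
      (edgeLabel_of_lt lam.order lam.p h02 e1 he1).1,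
      (edgeLabel_of_lt lam.order lam.p h12 e0 he0).2,
      (edgeLabel_of_lt lam.order lam.p h01 e2 he2).2]
  cocycle v0 v1 v2 v3 h01 h12 h23 σ t0 t1 t2 t3 e01 hσ ht0 ht1 ht2 ht3 he01 := by
    have h02 := lam.order.lt_trans h01 h12
    have h13 := lam.order.lt_trans h12 h23
    have hface : ∀ (t : K.Simplices 2) (a b d : V), lam.order.Lt a b → lam.order.Lt b d →
        (t.1 : Set V) = {a, b, d} → faceLabel lam.starts lam.p lam.c a t = lam.c t := by
      intro t a b d hab hbd ht
      rw [faceLabel, h, lam.order.firstVertices_triple ht hab hbd, edgeLabel_self, one_smul]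
    have key := smul_left_cancel _
      (lam.cocycle v0 v1 v2 v3 h01 h12 h23 σ t0 t1 t2 t3 hσ ht0 ht1 ht2 ht3)
    rwa [hface t2 v0 v1 v3 h01 h13 ht2, hface t0 v1 v2 v3 h12 h23 ht0,
      hface t1 v0 v2 v3 h02 h23 ht1, hface t3 v0 v1 v2 h01 h12 ht3, h,
      (edgeLabel_of_lt lam.order lam.p h01 e01 he01).1] at key

theorem FormalMap.toMarked_ofMarked (lam : MarkedFormalMap 𝒞 K)
    (h : lam.starts = lam.order.firstVertices) : (FormalMap.ofMarked lam h).toMarked = lam := by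
  obtain ⟨o, s, p, c, hb, hc⟩ := lam
  dsimp only at h
  subst h
  rfl

end ToMarked

/-! ### Continuity for the weak topology -/

namespace AbstractSimplicialComplex

section WeakTopology

variable {V : Type*} {K : AbstractSimplicialComplex V} {Y Z : Type*} [TopologicalSpace Y]
  [TopologicalSpace Z]

theorem Realization.ext {x y : K.Realization} (h : ∀ v, x.1 v = y.1 v) : x = y :=
  Subtype.ext (Finsupp.ext h)

theorem continuous_of_support_subset {σ : Finset V} (hσ : σ ∈ K.faces) {g : Y → K.Realization}
    (hg : ∀ v, Continuous fun y => (g y).1 v) (h : ∀ y, (g y).1.support ⊆ σ) : Continuous g := by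
  let τ : TopologicalSpace (K.closedSimplex σ) :=
    TopologicalSpace.induced (fun (x : K.closedSimplex σ) (v : V) => x.1.1 v) inferInstance
  have h1 : @Continuous Y (K.closedSimplex σ) _ τ fun y => ⟨g y, h y⟩ :=
    continuous_induced_rng.2 (continuous_pi hg)
  have h2 : @Continuous (K.closedSimplex σ) K.Realization τ _ Subtype.val :=
    continuous_iff_coinduced_le.2 (le_iSup (fun σ : K.faces => TopologicalSpace.coinduced
      (Subtype.val : K.closedSimplex σ.1 → K.Realization)
      (TopologicalSpace.induced (fun (x : K.closedSimplex σ.1) (v : V) => x.1.1 v) inferInstance))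
      ⟨σ, hσ⟩)
  exact @Continuous.comp _ _ _ _ τ _ _ _ h2 h1

/-- A map into a finite subcomplex is continuous if its barycentric coordinates are. -/
theorem continuous_of_finite_cover {F : Finset (Finset V)} (hF : ∀ σ ∈ F, σ ∈ K.faces)
    {g : Y → K.Realization} (hg : ∀ v, Continuous fun y => (g y).1 v)
    (h : ∀ y, ∃ σ ∈ F, (g y).1.support ⊆ σ) : Continuous g := by
  refine (locallyFinite_of_finite fun σ : F => {y | (g y).1.support ⊆ σ.1}).continuous ?_ ?_ ?_
  · refine Set.eq_univ_of_forall fun y => ?_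
    obtain ⟨σ, hσ, hy⟩ := h y
    exact Set.mem_iUnion.2 ⟨⟨σ, hσ⟩, hy⟩
  · intro σ
    have : {y | (g y).1.support ⊆ σ.1} = ⋂ v ∈ {v | v ∉ σ.1}, {y | (g y).1 v = 0} := by
      ext y
      simp only [Set.mem_ofPred_eq, Set.mem_iInter, Finset.subset_iff, Finsupp.mem_support_iff]
      exact forall_congr' fun v => not_imp_comm
    rw [this]
    exact isClosed_biInter fun v _ => isClosed_singleton.preimage (hg v)
  · intro σ
    rw [continuousOn_iff_continuous_domRestrict]
    exact continuous_of_support_subset (hF _ σ.2)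
      (fun v => (hg v).comp continuous_subtype_val) fun y => y.2

/-- The weak topology is the final topology for the maps into single closed simplices with
continuous barycentric coordinates. -/
theorem continuous_of_forall_simplex {V : Type u} {K : AbstractSimplicialComplex V}
    {f : K.Realization → Z}
    (h : ∀ σ ∈ K.faces, ∀ (Y : Type u) [TopologicalSpace Y] (g : Y → K.Realization),
      (∀ v, Continuous fun y => (g y).1 v) → (∀ y, (g y).1.support ⊆ σ) → Continuous (f ∘ g)) :
    Continuous f := by
  refine continuous_iSup_dom.2 fun σ => continuous_coinduced_dom.2 ?_
  let τ : TopologicalSpace (K.closedSimplex σ.1) :=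
    TopologicalSpace.induced (fun (x : K.closedSimplex σ.1) (v : V) => x.1.1 v) inferInstance
  exact @h σ.1 σ.2 (K.closedSimplex σ.1) τ Subtype.val
    (fun v => (continuous_apply v).comp continuous_induced_dom) (fun x => x.2)

end WeakTopology

/-! ### The prism -/

section Prism

/-- The vertex of `K` below or above which a vertex of the prism lies. -/
def prismProj {V : Type*} : V ⊕ V → V := Sum.elim id id

/-- The standard subdivision of `K × I`, for a linear order on the vertices: a simplex spans over a
simplex of `K`, and its vertices at the bottom (`Sum.inl`) do not exceed its vertices at the top
(`Sum.inr`). -/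
def prism {V : Type*} [LinearOrder V] (K : AbstractSimplicialComplex V) :
    AbstractSimplicialComplex (V ⊕ V) where
  faces := {τ | τ.image prismProj ∈ K.faces ∧ ∀ v w, Sum.inl v ∈ τ → Sum.inr w ∈ τ → v ≤ w}
  isRelLowerSet_faces := by
    intro τ hτ
    refine ⟨Finset.image_nonempty.1 (K.isRelLowerSet_faces hτ.1).1, fun ρ hρ hne => ⟨?_, ?_⟩⟩
    · exact face_of_subset hτ.1 (Finset.image_subset_image hρ) (hne.image _)
    · exact fun v w hv hw => hτ.2 v w (hρ hv) (hρ hw)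
  singleton_mem := by
    intro v
    refine ⟨?_, ?_⟩
    · rw [Finset.image_singleton]
      exact K.singleton_mem _
    · intro u w hu hw
      rw [Finset.mem_singleton] at hu hw
      simp [← hw] at hu

/-- The part of the mass `x` that is moved to the top at height `t`: the vertices are filled up to
total mass `t`, the last vertex first. -/
noncomputable def upperPart {V : Type*} [LinearOrder V] (x : V →₀ ℝ) (t : ℝ) : V →₀ ℝ :=
  Finsupp.onFinset x.support (fun v => min (x v) (max 0 (t - ∑ w ∈ x.support with v < w, x w)))
    fun v hv => by
      rw [Finsupp.mem_support_iff]
      intro h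
      simp [h] at hv

variable {V : Type*} [LinearOrder V]

theorem upperPart_apply {x : V →₀ ℝ} {σ : Finset V} (hσ : x.support ⊆ σ) (t : ℝ) (v : V) :
    upperPart x t v = min (x v) (max 0 (t - ∑ w ∈ σ with v < w, x w)) := by
  rw [upperPart, Finsupp.onFinset_apply,
    Finset.sum_subset (Finset.filter_subset_filter (v < ·) hσ)]
  intro w hw hw'
  by_contra h
  exact hw' (Finset.mem_filter.2 ⟨Finsupp.mem_support_iff.2 h, (Finset.mem_filter.1 hw).2⟩)

theorem sum_min_max (s : Finset V) (x : V → ℝ) (hx : ∀ v, 0 ≤ x v) (t : ℝ) :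
    ∑ v ∈ s, min (x v) (max 0 (t - ∑ w ∈ s with v < w, x w)) = max 0 (min t (∑ v ∈ s, x v)) := by
  induction s using Finset.induction_on_max generalizing t with
  | empty => simp
  | insert a s hs ih =>
    have ha : a ∉ s := fun h => lt_irrefl a (hs a h)
    have h1 : ∀ v ∈ s, ∑ w ∈ insert a s with v < w, x w = x a + ∑ w ∈ s with v < w, x w := by
      intro v hv
      rw [Finset.filter_insert, if_pos (hs v hv), Finset.sum_insert (by simp [ha])]
    have h2 : ∑ w ∈ insert a s with a < w, x w = 0 := by
      rw [Finset.filter_insert, if_neg (lt_irrefl a),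
        Finset.filter_false_of_mem fun w hw => (hs w hw).asymm, Finset.sum_empty]
    rw [Finset.sum_insert ha, Finset.sum_insert ha, h2, Finset.sum_congr rfl
      (g := fun v => min (x v) (max 0 ((t - x a) - ∑ w ∈ s with v < w, x w)))
      (fun v hv => by rw [h1 v hv, sub_sub]), ih]
    have h3 := hx a
    have h4 : 0 ≤ ∑ v ∈ s, x v := Finset.sum_nonneg fun v _ => hx v
    generalize ∑ v ∈ s, x v = S at *
    generalize x a = y at *
    grind

/-- A distribution of mass between bottom and top in which no bottom vertex exceeds a top vertex is
recovered from the total mass at each vertex and the total mass at the top. -/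
theorem min_max_eq (s : Finset V) (a b : V → ℝ) (ha : ∀ v, 0 ≤ a v) (hb : ∀ v, 0 ≤ b v)
    (h : ∀ v w, a v ≠ 0 → b w ≠ 0 → v ≤ w) {v : V} (hv : v ∈ s) :
    min (a v + b v) (max 0 (∑ w ∈ s, b w - ∑ w ∈ s with v < w, (a w + b w))) = b v := by
  rw [← Finset.sum_filter_add_sum_filter_not s (v < ·) b, Finset.sum_add_distrib]
  have hA : 0 ≤ ∑ w ∈ s with v < w, a w := Finset.sum_nonneg fun w _ => ha w
  have hA' : b v ≠ 0 → ∑ w ∈ s with v < w, a w = 0 := fun hbv =>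
    Finset.sum_eq_zero fun w hw => by
      by_contra haw
      exact (h w v haw hbv).not_gt (Finset.mem_filter.1 hw).2
  have hvs : v ∈ s.filter fun w => ¬ v < w := Finset.mem_filter.2 ⟨hv, lt_irrefl v⟩
  have hB : b v ≤ ∑ w ∈ s with ¬ v < w, b w := Finset.single_le_sum (fun w _ => hb w) hvs
  have hB' : a v ≠ 0 → ∑ w ∈ s with ¬ v < w, b w = b v := fun hav =>
    Finset.sum_eq_single_of_mem v hvs fun w hw hwv => by
      by_contra hbw
      exact (Finset.mem_filter.1 hw).2 (lt_of_le_of_ne (h v w hav hbw) hwv.symm)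
  have h1 := ha v
  have h2 := hb v
  generalize ∑ w ∈ s with v < w, a w = A at *
  generalize ∑ w ∈ s with ¬ v < w, b w = B at *
  generalize ∑ w ∈ s with v < w, b w = B' at *
  grind

variable {K : AbstractSimplicialComplex V}

/-- The projection of the realisation of the prism to that of `K`. -/
noncomputable def prismBase (y : (prism K).Realization) : K.Realization :=
  ⟨y.1.comapDomain Sum.inl Sum.inl_injective.injOn +
    y.1.comapDomain Sum.inr Sum.inr_injective.injOn, by
    refine ⟨fun v => add_nonneg (y.2.1 _) (y.2.1 _), ?_, ?_⟩
    · convert y.2.2.1.1 using 1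
      ext v
      have h1 := y.2.1 (Sum.inl v)
      have h2 := y.2.1 (Sum.inr v)
      simp only [Finsupp.mem_support_iff, Finsupp.add_apply, Finsupp.comapDomain_apply,
        Finset.mem_image, Sum.exists, prismProj, Sum.elim_inl, Sum.elim_inr, id_eq,
        exists_eq_right]
      rw [← not_and_or, not_iff_not]
      exact add_eq_zero_iff_of_nonneg h1 h2
    · have h := y.2.2.2
      rw [← Finsupp.comapDomain_sumElim_comapDomain y.1, Finsupp.sum_sumElim] at h
      rw [Finsupp.sum_add_index' (fun _ => rfl) (fun _ _ _ => rfl)]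
      exact h⟩

theorem prismBase_apply (y : (prism K).Realization) (v : V) :
    (prismBase y).1 v = y.1 (Sum.inl v) + y.1 (Sum.inr v) := rfl

/-- The height of a point of the prism: its total mass at the top. -/
noncomputable def prismHeight (y : (prism K).Realization) : unitInterval :=
  ⟨(y.1.comapDomain Sum.inr Sum.inr_injective.injOn).sum fun _ r => r, by
    have h := y.2.2.2
    rw [← Finsupp.comapDomain_sumElim_comapDomain y.1, Finsupp.sum_sumElim] at h
    have h0 : 0 ≤ (y.1.comapDomain Sum.inl Sum.inl_injective.injOn).sum fun _ r => r :=
      Finset.sum_nonneg fun v _ => y.2.1 _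
    have h1 : 0 ≤ (y.1.comapDomain Sum.inr Sum.inr_injective.injOn).sum fun _ r => r :=
      Finset.sum_nonneg fun v _ => y.2.1 _
    refine ⟨h1, ?_⟩
    change (Finsupp.sum _ fun _ r => r) + (Finsupp.sum _ fun _ r => r) = 1 at h
    linarith⟩

theorem prismHeight_eq (y : (prism K).Realization) {σ : Finset V}
    (hσ : ∀ v, y.1 (Sum.inr v) ≠ 0 → v ∈ σ) :
    (prismHeight y : ℝ) = ∑ v ∈ σ, y.1 (Sum.inr v) :=
  Finsupp.sum_of_support_subset (y.1.comapDomain Sum.inr Sum.inr_injective.injOn)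
    (fun v hv => hσ v (Finsupp.mem_support_iff (f := y.1.comapDomain Sum.inr _).1 hv))
    (fun _ r => r) fun _ _ => rfl

theorem sum_upperPart (x : K.Realization) (t : unitInterval) :
    ((upperPart x.1 t).sum fun _ r => r) = t := by
  rw [upperPart, Finsupp.onFinset_sum _ fun _ => rfl, sum_min_max _ _ x.2.1]
  have h : ∑ v ∈ x.1.support, x.1 v = 1 := x.2.2.2
  rw [h, min_eq_left t.2.2, max_eq_right t.2.1]

theorem upperPart_nonneg (x : K.Realization) (t : ℝ) (v : V) : 0 ≤ upperPart x.1 t v :=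
  le_min (x.2.1 v) (le_max_left _ _)

theorem upperPart_le (x : V →₀ ℝ) (t : ℝ) (v : V) : upperPart x t v ≤ x v :=
  min_le_left _ _

/-- The point of the prism at height `t` above `x`. -/
noncomputable def prismPoint (x : K.Realization) (t : unitInterval) : (prism K).Realization :=
  ⟨(x.1 - upperPart x.1 t).sumElim (upperPart x.1 t), by
    have hx : ((x.1 - upperPart x.1 t).sum fun _ r => r) + (upperPart x.1 t).sum (fun _ r => r)
        = 1 := by
      rw [← Finsupp.sum_add_index' (fun _ => rfl) (fun _ _ _ => rfl), sub_add_cancel]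
      exact x.2.2.2
    have hsum : ((x.1 - upperPart x.1 t).sumElim (upperPart x.1 t)).sum (fun _ r => r) = 1 := by
      rw [Finsupp.sum_sumElim]
      exact hx
    refine ⟨?_, ⟨?_, ?_⟩, hsum⟩
    · rintro (v | v)
      · exact sub_nonneg.2 (upperPart_le _ _ _)
      · exact upperPart_nonneg _ _ _
    · refine face_of_subset x.2.2.1 ?_ ?_
      · intro v hv
        rw [Finset.mem_image] at hv
        obtain ⟨w, hw, rfl⟩ := hv
        rw [Finsupp.mem_support_iff] at hw ⊢
        intro h0
        have h1 := upperPart_le x.1 t (prismProj w)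
        have h2 := upperPart_nonneg x t (prismProj w)
        rw [h0] at h1
        have h3 := le_antisymm h1 h2
        apply hw
        rcases w with w | w
        · change x.1 w - upperPart x.1 t w = 0
          exact sub_eq_zero.2 (h0.trans h3.symm)
        · exact h3
      · rw [Finset.image_nonempty, Finset.nonempty_iff_ne_empty]
        intro h0
        rw [Finsupp.sum, h0, Finset.sum_empty] at hsum
        exact zero_ne_one hsum
    · intro v w hv hw
      rw [Finsupp.mem_support_iff] at hv hw
      change x.1 v - upperPart x.1 t v ≠ 0 at hv
      change upperPart x.1 t w ≠ 0 at hw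
      by_contra! hwv
      rw [upperPart_apply subset_rfl] at hv hw
      have hv0 : v ∈ x.1.support := by
        rw [Finsupp.mem_support_iff]
        intro h0
        simp [h0] at hv
      have hle : x.1 v + ∑ u ∈ x.1.support with v < u, x.1 u ≤
          ∑ u ∈ x.1.support with w < u, x.1 u := by
        rw [← Finset.sum_insert (s := x.1.support.filter (v < ·)) (f := x.1) (a := v) (by simp)]
        refine Finset.sum_le_sum_of_subset_of_nonneg ?_ fun u _ _ => x.2.1 u
        intro u hu
        rw [Finset.mem_insert, Finset.mem_filter] at hu
        rw [Finset.mem_filter]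
        rcases hu with rfl | hu
        · exact ⟨hv0, hwv⟩
        · exact ⟨hu.1, hwv.trans hu.2⟩
      have h1 := x.2.1 v
      have h2 := x.2.1 w
      grind⟩

theorem prismPoint_inl (x : K.Realization) (t : unitInterval) (v : V) :
    (prismPoint x t).1 (Sum.inl v) = x.1 v - upperPart x.1 t v := rfl

theorem prismPoint_inr (x : K.Realization) (t : unitInterval) (v : V) :
    (prismPoint x t).1 (Sum.inr v) = upperPart x.1 t v := rfl

theorem prismPoint_base_height (y : (prism K).Realization) :
    prismPoint (prismBase y) (prismHeight y) = y := by
  have hs : ∀ v, v ∈ (prismBase y).1.support ↔ y.1 (Sum.inl v) ≠ 0 ∨ y.1 (Sum.inr v) ≠ 0 := by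
    intro v
    rw [Finsupp.mem_support_iff, prismBase_apply, Ne,
      add_eq_zero_iff_of_nonneg (y.2.1 _) (y.2.1 _), not_and_or]
  have key : ∀ v, upperPart (prismBase y).1 (prismHeight y) v = y.1 (Sum.inr v) := by
    intro v
    by_cases hv : v ∈ (prismBase y).1.support
    · rw [upperPart_apply subset_rfl, prismHeight_eq y fun w hw => (hs w).2 (Or.inr hw)]
      simp only [prismBase_apply]
      exact min_max_eq _ (fun v => y.1 (Sum.inl v)) (fun v => y.1 (Sum.inr v)) (fun _ => y.2.1 _)
        (fun _ => y.2.1 _) (fun v w hv hw => y.2.2.1.2 v w (Finsupp.mem_support_iff.2 hv)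
          (Finsupp.mem_support_iff.2 hw)) hv
    · have h0 : (prismBase y).1 v = 0 := Finsupp.notMem_support_iff.1 hv
      rw [hs, not_or, not_not, not_not] at hv
      rw [hv.2]
      refine le_antisymm ?_ (upperPart_nonneg _ _ _)
      exact (upperPart_le _ _ _).trans h0.le
  refine Realization.ext ?_
  rintro (v | v)
  · rw [prismPoint_inl, key, prismBase_apply, add_sub_cancel_right]
  · rw [prismPoint_inr, key]

theorem continuous_prismBase : Continuous (prismBase (K := K)) := by
  refine continuous_of_forall_simplex fun τ hτ Y _ g hg h => ?_
  refine continuous_of_support_subset hτ.1 (fun v => (hg _).add (hg _)) fun y v hv => ?_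
  rw [Finsupp.mem_support_iff] at hv
  change (g y).1 (Sum.inl v) + (g y).1 (Sum.inr v) ≠ 0 at hv
  rw [Finset.mem_image]
  by_contra! hne
  have h0 : ∀ w, prismProj w = v → (g y).1 w = 0 := fun w hw =>
    Finsupp.notMem_support_iff.1 fun hw' => hne w (h y hw') hw
  rw [h0 (Sum.inl v) rfl, h0 (Sum.inr v) rfl, add_zero] at hv
  exact hv rfl

theorem continuous_prismHeight : Continuous (prismHeight (K := K)) := by
  refine continuous_of_forall_simplex fun τ hτ Y _ g hg h => ?_
  refine continuous_induced_rng.2 ?_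
  have : (Subtype.val ∘ prismHeight ∘ g : Y → ℝ) =
      fun y => ∑ v ∈ τ.image prismProj, (g y).1 (Sum.inr v) := by
    funext y
    exact prismHeight_eq (g y) fun v hv =>
      Finset.mem_image.2 ⟨Sum.inr v, h y (Finsupp.mem_support_iff.2 hv), rfl⟩
  rw [this]
  exact continuous_finsetSum _ fun v _ => hg _

theorem continuous_prismPoint_comp {Y : Type*} [TopologicalSpace Y] {σ : Finset V}
    {g : Y → K.Realization} (hg : ∀ v, Continuous fun y => (g y).1 v)
    (h : ∀ y, (g y).1.support ⊆ σ) :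
    Continuous fun z : Y × unitInterval => prismPoint (g z.1) z.2 := by
  classical
  have hup : ∀ v, Continuous fun z : Y × unitInterval => upperPart (g z.1).1 z.2 v := by
    intro v
    have : (fun z : Y × unitInterval => upperPart (g z.1).1 z.2 v) = fun z =>
        min ((g z.1).1 v) (max 0 ((z.2 : ℝ) - ∑ w ∈ σ with v < w, (g z.1).1 w)) :=
      funext fun z => upperPart_apply (h z.1) _ _
    rw [this]
    have hg' : ∀ v, Continuous fun z : Y × unitInterval => (g z.1).1 v :=
      fun v => (hg v).comp continuous_fst
    exact (hg' v).min (continuous_const.max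
      ((continuous_subtype_val.comp continuous_snd).sub (continuous_finsetSum _ fun w _ => hg' w)))
  refine continuous_of_finite_cover
    (F := (σ.disjSum σ).powerset.filter fun τ => τ ∈ (prism K).faces)
    (fun τ hτ => (Finset.mem_filter.1 hτ).2) ?_ fun z => ?_
  · rintro (v | v)
    · exact ((hg v).comp continuous_fst).sub (hup v)
    · exact hup v
  · refine ⟨_, Finset.mem_filter.2 ⟨Finset.mem_powerset.2 ?_, (prismPoint (g z.1) z.2).2.2.1⟩,
      subset_rfl⟩
    have hz : ∀ v, v ∉ σ → (g z.1).1 v = 0 ∧ upperPart (g z.1).1 z.2 v = 0 := by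
      intro v hv
      have h0 := Finsupp.notMem_support_iff.1 fun hv' => hv (h z.1 hv')
      exact ⟨h0, le_antisymm ((upperPart_le _ _ _).trans h0.le) (upperPart_nonneg _ _ _)⟩
    rintro (v | v) hv <;> rw [Finsupp.mem_support_iff] at hv
    · rw [Finset.inl_mem_disjSum]
      by_contra hvσ
      rw [prismPoint_inl, (hz v hvσ).1, (hz v hvσ).2, sub_zero] at hv
      exact hv rfl
    · rw [Finset.inr_mem_disjSum]
      by_contra hvσ
      exact hv (hz v hvσ).2

/-- Since the weak topology is only a final topology, continuity on the product with the interval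
is checked after currying, which is possible because the interval is locally compact. -/
theorem continuous_prismPoint :
    Continuous fun z : K.Realization × unitInterval => prismPoint z.1 z.2 := by
  have h1 : ∀ x : K.Realization, Continuous fun t : unitInterval => prismPoint x t := by
    intro x
    have hx : Continuous fun z : PUnit.{1} × unitInterval => prismPoint x z.2 :=
      continuous_prismPoint_comp (g := fun _ => x) (fun _ => continuous_const)
        (fun _ => subset_rfl)
    have ht : Continuous fun t : unitInterval => ((PUnit.unit : PUnit.{1}), t) :=
      Continuous.prodMk_right _
    exact Continuous.comp (f := fun t : unitInterval => ((PUnit.unit : PUnit.{1}), t))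
      (g := fun z => prismPoint x z.2) hx ht
  let f : K.Realization → C(unitInterval, (prism K).Realization) := fun x => ⟨prismPoint x, h1 x⟩
  have hf : Continuous f := by
    refine continuous_of_forall_simplex fun σ hσ Y _ g hg h => ?_
    refine ContinuousMap.continuous_of_continuous_uncurry _ ?_
    exact continuous_prismPoint_comp hg h
  exact ContinuousMap.continuous_uncurry_of_continuous ⟨f, hf⟩

/-- The prism triangulates the product of `|K|` with the interval. -/
noncomputable def prismHomeomorph (K : AbstractSimplicialComplex V) :
    (prism K).Realization ≃ₜ K.Realization × unitInterval where
  toFun y := (prismBase y, prismHeight y)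
  invFun z := prismPoint z.1 z.2
  left_inv := prismPoint_base_height
  right_inv := by
    rintro ⟨x, t⟩
    refine Prod.ext (Realization.ext fun v => ?_) (Subtype.ext ?_)
    · exact sub_add_cancel _ _
    · refine Eq.trans ?_ (sum_upperPart x t)
      change (Finsupp.sum (Finsupp.comapDomain Sum.inr (Finsupp.sumElim _ _) _) fun _ r => r) = _
      rw [Finsupp.comapDomain_inr_sumElim]
  continuous_toFun := continuous_prismBase.prodMk continuous_prismHeight
  continuous_invFun := continuous_prismPoint

end Prism

end AbstractSimplicialComplex

/-! ### The cylinder and its vertex orders -/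

namespace AbstractSimplicialComplex

section Cylinder

variable {V : Type u} [LinearOrder V] (K : AbstractSimplicialComplex V)

theorem exists_face_prismProj {τ : Finset (V ⊕ V)} (hτ : τ ∈ (prism K).faces) :
    ∃ σ ∈ K.faces, ∀ v ∈ τ, prismProj v ∈ σ :=
  ⟨_, hτ.1, fun _ hv => Finset.mem_image_of_mem _ hv⟩

/-- The inclusion of `K` as the bottom of the prism. -/
def prismBottom : Embedding K (prism K) where
  toEmbedding := Function.Embedding.inl
  map_mem σ hσ := by
    refine ⟨?_, fun v w _ hw => by simp at hw⟩
    rw [Finset.map_eq_image, Finset.image_image]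
    exact (Finset.image_id (s := σ)).symm ▸ hσ

/-- The inclusion of `K` as the top of the prism. -/
def prismTop : Embedding K (prism K) where
  toEmbedding := Function.Embedding.inr
  map_mem σ hσ := by
    refine ⟨?_, fun v w hv _ => by simp at hv⟩
    rw [Finset.map_eq_image, Finset.image_image]
    exact (Finset.image_id (s := σ)).symm ▸ hσ

theorem realize_prismBottom_inl (x : K.Realization) (v : V) :
    ((prismBottom K).realize x).1 (Sum.inl v) = x.1 v :=
  Finsupp.embDomain_apply_self _ _ _

theorem realize_prismBottom_inr (x : K.Realization) (v : V) :
    ((prismBottom K).realize x).1 (Sum.inr v) = 0 :=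
  Finsupp.embDomain_of_notMem_range _ _ _ (by rintro ⟨w, hw⟩; exact Sum.inl_ne_inr hw)

theorem realize_prismTop_inr (x : K.Realization) (v : V) :
    ((prismTop K).realize x).1 (Sum.inr v) = x.1 v :=
  Finsupp.embDomain_apply_self _ _ _

theorem realize_prismTop_inl (x : K.Realization) (v : V) :
    ((prismTop K).realize x).1 (Sum.inl v) = 0 :=
  Finsupp.embDomain_of_notMem_range _ _ _ (by rintro ⟨w, hw⟩; exact Sum.inr_ne_inl hw)

variable {X : Type*} [TopologicalSpace X] (h : K.Realization ≃ₜ X)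

/-- The prism as a triangulation of `X × I`. -/
noncomputable def prismCylinder : CylinderTriangulation h h where
  Vert := V ⊕ V
  T := prism K
  homeo := (prismHomeomorph K).trans (h.prodCongr (Homeomorph.refl _))
  i₀ := prismBottom K
  i₁ := prismTop K
  homeo_i₀ x := by
    refine Prod.ext (congrArg h (Realization.ext fun v => ?_)) (Subtype.ext ?_)
    · rw [prismBase_apply, realize_prismBottom_inl, realize_prismBottom_inr, add_zero]
    · change (prismHeight _ : ℝ) = 0
      rw [prismHeight_eq _ (σ := ∅) fun v hv => absurd (realize_prismBottom_inr K x v) hv,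
        Finset.sum_empty]
  homeo_i₁ x := by
    refine Prod.ext (congrArg h (Realization.ext fun v => ?_)) (Subtype.ext ?_)
    · rw [prismBase_apply, realize_prismTop_inl, realize_prismTop_inr, zero_add]
    · change (prismHeight _ : ℝ) = 1
      rw [prismHeight_eq _ (σ := x.1.support) fun v hv => Finsupp.mem_support_iff.2
        ((realize_prismTop_inr K x v).symm.trans_ne hv)]
      simp only [realize_prismTop_inr]
      exact x.2.2.2

theorem eq_of_vertexPoint_apply_ne_zero {v w : V} (hw : (K.vertexPoint v).1 w ≠ 0) : v = w := by
  by_contra hne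
  exact hw (Finsupp.single_eq_of_ne' hne)

theorem eq_vertexPoint {x : K.Realization} {v : V} (hx : ∀ w, w ≠ v → x.1 w = 0) :
    x = K.vertexPoint v := by
  have h1 : (x.1.sum fun _ r => r) = x.1 v :=
    Finsupp.sum_eq_single v (fun w _ hw => hx w hw) fun _ => rfl
  refine Realization.ext fun w => ?_
  by_cases hw : w = v
  · subst hw
    exact (h1.symm.trans x.2.2.2).trans Finsupp.single_eq_same.symm
  · exact (hx w hw).trans (Finsupp.single_eq_of_ne hw).symm

theorem pair_mem_prism (v : V) : {Sum.inl v, Sum.inr v} ∈ (prism K).faces := by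
  refine ⟨?_, ?_⟩
  · have h1 : ({Sum.inl v, Sum.inr v} : Finset (V ⊕ V)).image prismProj = {v} := by
      simp [Finset.image_insert, prismProj]
    rw [h1]
    exact K.singleton_mem v
  · intro u w hu hw
    simp only [Finset.mem_insert, Finset.mem_singleton, Sum.inl.injEq, reduceCtorEq, or_false,
      Sum.inr.injEq, false_or] at hu hw
    rw [hu, hw]

theorem prismBase_eq_vertexPoint {v : V} {y : (prism K).Realization}
    (hy : y.1.support ⊆ {Sum.inl v, Sum.inr v}) : prismBase y = K.vertexPoint v := by
  refine eq_vertexPoint K fun w hw => ?_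
  have h0 : ∀ w', prismProj w' = w → y.1 w' = 0 := by
    intro w' hw'
    by_contra h0
    have h1 := hy (Finsupp.mem_support_iff.2 h0)
    rw [Finset.mem_insert, Finset.mem_singleton] at h1
    rcases h1 with rfl | rfl <;> exact hw hw'.symm
  rw [prismBase_apply, h0 _ rfl, h0 _ rfl, add_zero]

theorem support_prismPoint_vertexPoint (v : V) (t : unitInterval) :
    (prismPoint (K.vertexPoint v) t).1.support ⊆ {Sum.inl v, Sum.inr v} := by
  have h0 : ∀ w, w ≠ v → (K.vertexPoint v).1 w = 0 ∧ upperPart (K.vertexPoint v).1 t w = 0 := by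
    intro w hw
    have h1 : (K.vertexPoint v).1 w = 0 := Finsupp.single_eq_of_ne hw
    exact ⟨h1, le_antisymm ((upperPart_le _ _ _).trans h1.le) (upperPart_nonneg _ _ _)⟩
  rintro (w | w) hw <;> rw [Finsupp.mem_support_iff] at hw <;>
    have : w = v := by_contra fun hne => hw (by
      simp only [prismPoint_inl, prismPoint_inr, h0 w hne, sub_zero])
  · simp [this]
  · simp [this]

theorem prismCylinder_containsLines {m : Set X} (hm : ∀ x ∈ m, ∃ v : V, h (K.vertexPoint v) = x) :
    (prismCylinder K h).ContainsLines m := by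
  intro x hx r
  obtain ⟨v, rfl⟩ := hm x hx
  refine ⟨({Sum.inl v, Sum.inr v} : Finset (V ⊕ V)), pair_mem_prism K v,
    fun y hy => congrArg h (prismBase_eq_vertexPoint K hy), ?_⟩
  have hsymm : (prismCylinder K h).homeo.symm (h (K.vertexPoint v), r) =
      prismPoint (K.vertexPoint v) r := by
    change prismPoint (h.symm (h (K.vertexPoint v))) r = _
    rw [h.symm_apply_apply]
  rw [hsymm]
  exact support_prismPoint_vertexPoint K v r

theorem prismBase_vertexPoint (w : V ⊕ V) :
    prismBase ((prism K).vertexPoint w) = K.vertexPoint (prismProj w) := by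
  refine Realization.ext fun v => ?_
  rw [prismBase_apply]
  rcases w with w | w <;> simp [vertexPoint, prismProj, Finsupp.single_apply]

/-- A simplex of the prism on the line over a vertex projects to that vertex. -/
theorem prismProj_eq_of_onLine {v : V} {τ : Finset (V ⊕ V)}
    (hτ : (prismCylinder K h).OnLine (h (K.vertexPoint v)) τ) {w : V ⊕ V} (hw : w ∈ τ) :
    prismProj w = v := by
  have h1 := hτ ((prism K).vertexPoint w) (by
    intro u hu
    rw [Finsupp.mem_support_iff] at hu
    have : w = u := by
      by_contra hne
      exact hu (Finsupp.single_eq_of_ne' hne)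
    exact this ▸ hw)
  have h2 := h.injective h1
  change prismBase _ = _ at h2
  rw [prismBase_vertexPoint] at h2
  refine (K.eq_of_vertexPoint_apply_ne_zero (v := v) ?_).symm
  rw [← h2]
  exact (Finsupp.single_eq_same.trans_ne one_ne_zero)

variable {K}

/-- The vertex order on the prism that is `o₀` at the bottom, `o₁` at the top, and puts the bottom
before the top. -/
def prismOrder (o₀ o₁ : VertexOrder K) : VertexOrder (prism K) where
  toPartialOrder :=
    { le := Sum.Lex o₀.Le o₁.Le
      lt := fun a b => Sum.Lex o₀.Le o₁.Le a b ∧ ¬ Sum.Lex o₀.Le o₁.Le b a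
      le_refl := by
        rintro (v | v)
        · exact Sum.Lex.inl (o₀.le_refl v)
        · exact Sum.Lex.inr (o₁.le_refl v)
      le_trans := by
        rintro _ _ _ (h | h | h) (h' | h' | h')
        · exact Sum.Lex.inl (o₀.toPartialOrder.le_trans _ _ _ h h')
        · exact Sum.Lex.sep _ _
        · exact Sum.Lex.inr (o₁.toPartialOrder.le_trans _ _ _ h h')
        · exact Sum.Lex.sep _ _
      le_antisymm := by
        rintro _ _ (h | h | h) (h' | h' | h')
        · exact congrArg _ (o₀.toPartialOrder.le_antisymm _ _ h h')
        · exact congrArg _ (o₁.toPartialOrder.le_antisymm _ _ h h') }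
  total := by
    rintro τ hτ (v | v) hv (w | w) hw
    · exact (o₀.total _ hτ.1 v (Finset.mem_image_of_mem prismProj hv) w
        (Finset.mem_image_of_mem prismProj hw)).imp Sum.Lex.inl Sum.Lex.inl
    · exact Or.inl (Sum.Lex.sep _ _)
    · exact Or.inr (Sum.Lex.sep _ _)
    · exact (o₁.total _ hτ.1 v (Finset.mem_image_of_mem prismProj hv) w
        (Finset.mem_image_of_mem prismProj hw)).imp Sum.Lex.inr Sum.Lex.inr

theorem prismOrder_bottom (o₀ o₁ : VertexOrder K) (u v : V) :
    (prismOrder o₀ o₁).Le ((prismBottom K).toEmbedding u) ((prismBottom K).toEmbedding v) ↔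
      o₀.Le u v :=
  Sum.lex_inl_inl

theorem prismOrder_top (o₀ o₁ : VertexOrder K) (u v : V) :
    (prismOrder o₀ o₁).Le ((prismTop K).toEmbedding u) ((prismTop K).toEmbedding v) ↔
      o₁.Le u v :=
  Sum.lex_inr_inr

/-- Start vertices at the bottom and at the top extend to the prism: the two ends have no simplex in
common, and any vertex will do for the simplices in neither of them. -/
theorem exists_prism_starts (s₀ s₁ : StartVertices K) : ∃ s : StartVertices (prism K),
    (∀ σ : K.faces, s.start ((prismBottom K).mapFace σ) =
      (prismBottom K).toEmbedding (s₀.start σ)) ∧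
    (∀ σ : K.faces, s.start ((prismTop K).mapFace σ) = (prismTop K).toEmbedding (s₁.start σ)) := by
  have key : ∀ τ : (prism K).faces, ∃ w ∈ τ.1,
      (∀ σ : K.faces, (prismBottom K).mapFace σ = τ →
        w = (prismBottom K).toEmbedding (s₀.start σ)) ∧
      (∀ σ : K.faces, (prismTop K).mapFace σ = τ →
        w = (prismTop K).toEmbedding (s₁.start σ)) := by
    intro τ
    have hinj : ∀ (i : Embedding K (prism K)) (σ σ' : K.faces), i.mapFace σ = i.mapFace σ' →
        σ = σ' := fun i σ σ' hσ =>
      Subtype.ext (Finset.map_injective i.toEmbedding (congrArg Subtype.val hσ))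
    have hdisj : ∀ σ σ' : K.faces, (prismBottom K).mapFace σ ≠ (prismTop K).mapFace σ' := by
      intro σ σ' heq
      have h1 : Sum.inl (s₀.start σ) ∈ ((prismTop K).mapFace σ').1 :=
        heq ▸ Finset.mem_map_of_mem _ (s₀.start_mem σ)
      obtain ⟨v, -, hv⟩ := Finset.mem_map.1 h1
      exact Sum.inr_ne_inl hv
    by_cases h0 : ∃ σ, (prismBottom K).mapFace σ = τ
    · obtain ⟨σ, rfl⟩ := h0
      refine ⟨_, Finset.mem_map_of_mem _ (s₀.start_mem σ), fun σ' hσ' => ?_, fun σ' hσ' => ?_⟩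
      · rw [hinj _ _ _ hσ']
      · exact absurd hσ'.symm (hdisj σ σ')
    by_cases h1 : ∃ σ, (prismTop K).mapFace σ = τ
    · obtain ⟨σ, rfl⟩ := h1
      refine ⟨_, Finset.mem_map_of_mem _ (s₁.start_mem σ), fun σ' hσ' => ?_, fun σ' hσ' => ?_⟩
      · exact absurd hσ' (hdisj σ' σ)
      · rw [hinj _ _ _ hσ']
    obtain ⟨w, hw⟩ := ((prism K).isRelLowerSet_faces τ.2).1
    exact ⟨w, hw, fun σ hσ => absurd ⟨σ, hσ⟩ h0, fun σ hσ => absurd ⟨σ, hσ⟩ h1⟩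
  choose f hf h0 h1 using key
  exact ⟨⟨f, hf⟩, fun σ => h0 _ σ rfl, fun σ => h1 _ σ rfl⟩

end Cylinder

end AbstractSimplicialComplex

/-! ### Equivalence with the relabelling -/

section Equivalence

open AbstractSimplicialComplex

variable {C P : Type*} [Group C] [Group P] [MulDistribMulAction P C] {𝒞 : CrossedModule C P}
  {V : Type u} [LinearOrder V] {K : AbstractSimplicialComplex V}

/-- The marked formal map on the prism obtained by pulling back along the projection to `K`. -/
noncomputable def MarkedFormalMap.prism (lam : MarkedFormalMap 𝒞 K)
    (o : VertexOrder (AbstractSimplicialComplex.prism K))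
    (s : StartVertices (AbstractSimplicialComplex.prism K)) :
    MarkedFormalMap 𝒞 (AbstractSimplicialComplex.prism K) :=
  (lam.toTotal.pullback prismProj fun _ => exists_face_prismProj K).toMarked o s

namespace MarkedFormalMap

variable (lam : MarkedFormalMap 𝒞 K) {o : VertexOrder (AbstractSimplicialComplex.prism K)}
  {s : StartVertices (AbstractSimplicialComplex.prism K)}

theorem prism_extends_bottom
    (ho : ∀ u v, o.Le ((prismBottom K).toEmbedding u) ((prismBottom K).toEmbedding v) ↔
      lam.order.Le u v)
    (hs : ∀ σ, s.start ((prismBottom K).mapFace σ) =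
      (prismBottom K).toEmbedding (lam.starts.start σ)) :
    (lam.prism o s).Extends (prismBottom K) lam := by
  have key : (lam.prism o s).Extends (prismBottom K) (lam.toTotal.toMarked lam.order lam.starts) :=
    TotalLabelling.extends_toMarked _ (fun _ _ => rfl) (fun _ _ _ => rfl) ho hs
  rwa [lam.toMarked_toTotal] at key

theorem prism_extends_top {o' : VertexOrder K} {s' : StartVertices K}
    (ho : ∀ u v, o.Le ((prismTop K).toEmbedding u) ((prismTop K).toEmbedding v) ↔ o'.Le u v)
    (hs : ∀ σ, s.start ((prismTop K).mapFace σ) = (prismTop K).toEmbedding (s'.start σ)) :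
    (lam.prism o s).Extends (prismTop K) (lam.toTotal.toMarked o' s') :=
  TotalLabelling.extends_toMarked _ (fun _ _ => rfl) (fun _ _ _ => rfl) ho hs

/-- The edges over a base point are collapsed by the projection, so they are labelled `1`. -/
theorem prism_p_eq_one {X : Type*} [TopologicalSpace X] {h : K.Realization ≃ₜ X} {v : V}
    {e : (AbstractSimplicialComplex.prism K).Simplices 1}
    (he : (prismCylinder K h).OnLine (h (K.vertexPoint v)) e.1) : (lam.prism o s).p e = 1 := by
  obtain ⟨b, hb⟩ := TotalLabelling.exists_end s e
  have hb' : b ∈ (e.1 : Set (V ⊕ V)) := by rw [hb]; simp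
  refine (TotalLabelling.edge_eq
    (lam.toTotal.pullback prismProj fun _ => exists_face_prismProj K) hb rfl).trans ?_
  change lam.toTotal.p (prismProj _) (prismProj b) = 1
  rw [prismProj_eq_of_onLine K h he hb', prismProj_eq_of_onLine K h he (s.start_mem e.toFace),
    TotalLabelling.p_self]

end MarkedFormalMap

end Equivalence

theorem mainTheorem10 {C P : Type*} [Group C] [Group P] [MulDistribMulAction P C]
    (𝒞 : CrossedModule C P) {V : Type u} (K : AbstractSimplicialComplex V)
    {X : Type*} [TopologicalSpace X] (h : K.Realization ≃ₜ X)
    (m : Set X) (hm : ∀ x ∈ m, ∃ v : V, h (K.vertexPoint v) = x) :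
    (∀ (lam : FormalMap 𝒞 K) (o : AbstractSimplicialComplex.VertexOrder K),
      ∃ mu : FormalMap 𝒞 K, mu.order = o ∧ lam.toMarked.IsRelabelling mu.toMarked ∧
        FormalMap.Equivalent m h h lam mu) ∧
    (∀ (lam : MarkedFormalMap 𝒞 K) (o : AbstractSimplicialComplex.VertexOrder K)
      (s : AbstractSimplicialComplex.StartVertices K),
      ∃ mu : MarkedFormalMap 𝒞 K, mu.order = o ∧ mu.starts = s ∧ lam.IsRelabelling mu ∧
        MarkedFormalMap.Equivalent m h h lam mu) := by
  -- The subdivision of the prism may use any linear order; it need not extend a given vertex order.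
  let _ : LinearOrder V := IsWellOrder.linearOrder WellOrderingRel
  have hlines := AbstractSimplicialComplex.prismCylinder_containsLines K h hm
  refine ⟨fun lam o => ?_, fun lam o s => ?_⟩
  · have hrel := lam.toMarked.isRelabelling_toMarked o o.firstVertices
    let oT := AbstractSimplicialComplex.prismOrder lam.order o
    let Lam := lam.toMarked.prism oT oT.firstVertices
    have h0 := AbstractSimplicialComplex.prismOrder_bottom lam.order o
    have h1 := AbstractSimplicialComplex.prismOrder_top lam.order o
    have e0 := lam.toMarked.prism_extends_bottom (o := oT) (s := oT.firstVertices) h0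
      (AbstractSimplicialComplex.VertexOrder.firstVertices_mapFace _ h0)
    have e1 := lam.toMarked.prism_extends_top (o := oT) (s := oT.firstVertices) h1
      (AbstractSimplicialComplex.VertexOrder.firstVertices_mapFace _ h1)
    refine ⟨FormalMap.ofMarked (lam.toMarked.toTotal.toMarked o o.firstVertices) rfl, rfl, ?_,
      AbstractSimplicialComplex.prismCylinder K h, FormalMap.ofMarked Lam rfl,
      ⟨e0.order, e0.p, e0.c⟩, ⟨e1.order, e1.p, e1.c⟩, hlines, fun x hx e he => ?_⟩
    · exact (FormalMap.toMarked_ofMarked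
        (lam.toMarked.toTotal.toMarked o o.firstVertices) rfl).symm ▸ hrel
    · obtain ⟨v, rfl⟩ := hm x hx
      exact lam.toMarked.prism_p_eq_one (o := oT) he
  · obtain ⟨sT, hs0, hs1⟩ := AbstractSimplicialComplex.exists_prism_starts lam.starts s
    have h0 := AbstractSimplicialComplex.prismOrder_bottom lam.order o
    have h1 := AbstractSimplicialComplex.prismOrder_top lam.order o
    refine ⟨lam.toTotal.toMarked o s, rfl, rfl, lam.isRelabelling_toMarked o s,
      AbstractSimplicialComplex.prismCylinder K h,
      lam.prism (AbstractSimplicialComplex.prismOrder lam.order o) sT,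
      lam.prism_extends_bottom h0 hs0, lam.prism_extends_top h1 hs1, hlines, fun x hx e he => ?_⟩
    obtain ⟨v, rfl⟩ := hm x hx
    exact lam.prism_p_eq_one he
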